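/- Let $(\mathcal C,\mathcal E)$ be an exact category in the sense of Quillen which is $\mathrm{Ext}$-small, i.e. for all objects $Z,A$ the equivalence classes of conflations $A\to X\to Z$ form a set $\mathrm{Ext}(Z,A)$. Then $\mathrm{Ext}(Z,A)$ is an abelian group under the Baer sum, and $\mathcal C$ is an extriangulated category $(\mathcal C,\mathrm{Ext},\mathfrak s)$, where $\mathfrak s$ sends an extension to the class of conflations that it is. For $x\in\mathrm{Ext}(Z,A)$, $a:A\to A'$ and $c:Z'\to Z$, write $a\cdot x\in \mathrm{Ext}(Z,A')$ and $x\cdot c\in\mathrm{Ext}(Z',A)$ for the pushout and the pullback of $x$. For a non-empty set $I$ (regarded as a discrete category), $\mathrm{Fun}(I,\mathcal C)$ is the extriangulated category with bifunctor $\prod_{i\in I}\mathrm{Ext}((-)_i,(?)_i)$ and componentwise realization, and $T:\mathcal C\to\mathrm{Fun}(I,\mathcal C)$ is the constant functor. When coproducts indexed by $I$ exist, $S=\coprod_{i\in I}(-):\mathrm{Fun}(I,\mathcal C)\to\mathcal C$ is the coproduct functor, and $\mu_i$ denotes the canonical inclusions into a coproduct. An additive functor $F$ between extriangulated categories is extriangulated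 if there is a natural transformation $\Gamma_F:\mathbb E(-,?)\to\mathbb E'(F-,F?)$ such that, if $x$ is realized by $A\to X\to Z$, then $\Gamma_F(x)$ is realized by $FA\to FX\to FZ$. The category $\mathcal C$ is AET3.5 if, for every set $I\neq\emptyset$, coproducts indexed by $I$ exist in $\mathcal C$ and $S$ is $(1,T)$-extriangulated, i.e. $S$ is additive and there is a natural transformation $$\Gamma:\prod_{i\in I}\mathrm{Ext}(Z_i,A)\to\mathrm{Ext}\Big(\coprod_{i\in I}Z_i,A^{(I)}\Big)\qquad (Z\in\mathrm{Fun}(I,\mathcal C),\ A\in\mathcal C)$$ such that, if $\eta_i$ is realized by $A\to X_i\to Z_i$ for all $i\in I$, then $\Gamma((\eta_i)_{i\in I})$ is realized by $A^{(I)}\to\coprod_i X_i\to\coprod_i Z_i$. It is AET4 if, for every set $I\neq\emptyset$, coproducts indexed by $I$ exist and such a $\Gamma$ can be chosen so that, moreover, $\Gamma((\eta_j)_{j\in I})\cdot\mu_i=\mu_i\cdot\eta_i$ for all families $(\eta_j)_{j\in I}$ and all $i\in I$. The following statements are equivalent. (a) $\mathcal C$ is an AET4 extriangulated category. (b) $\mathcal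 C$ is an AET3.5 extriangulated category. (c) $\mathcal C$ has coproducts and, for every set $I\neq\emptyset$, the functor $\coprod_{i\in I}(-):\mathrm{Fun}(I,\mathcal C)\to\mathcal C$ is extriangulated. (d) $\mathcal C$ has coproducts and, for every set $I\neq\emptyset$ and every family $\{A_i\xrightarrow{f_i}X_i\xrightarrow{g_i}Z_i\}_{i\in I}$ of conflations in $\mathcal C$, the sequence $\coprod_i A_i\xrightarrow{\coprod f_i}\coprod_i X_i\xrightarrow{\coprod g_i}\coprod_i Z_i$ is a conflation. (e) $\mathcal C$ has coproducts and, for every set $I\neq\emptyset$, the maps $\tau_{Z,A}:\mathrm{Ext}(\coprod_{i\in I}Z_i,A)\to\prod_{i\in I}\mathrm{Ext}(Z_i,A)$, $\eta\mapsto(\eta\cdot\mu_i)_{i\in I}$, define a natural isomorphism. Moreover, if these conditions hold, then for every $n\geq 1$ and every set $I\neq\emptyset$ the maps $$\mathrm{Ext}^n\Big(\coprod_{i\in I}Z_i,A\Big)\to\prod_{i\in I}\mathrm{Ext}^n(Z_i,A),\qquad \eta\mapsto(\eta\cdot\mu_i)_{i\in I},$$ define a natural isomorphism. Here $\mathrm{Ext}^1=\mathrm{Ext}$,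 and $\mathrm{Ext}^{n+1}(Z,A)$ is the abelian group generated by the products $x\cdot y$ with $x\in\mathrm{Ext}^n(M,A)$, $y\in\mathrm{Ext}(Z,M)$ and $M\in\mathcal C$, subject to biadditivity and to the relations $(x\cdot m)\cdot y=x\cdot(m\cdot y)$ for morphisms $m$ of $\mathcal C$. -/

import Mathlib

open CategoryTheory CategoryTheory.Limits Opposite

universe w v v₁ v₂ v₃ u u₁ u₂ u₃

namespace Extri

section Sequences

variable {C : Type u} [Category.{v} C] {D : Type u₁} [Category.{v₁} D]

/-- A sequence of two composable morphisms `A ⟶ X ⟶ Z` with prescribed ends `A` and `Z`. -/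
structure Seq (A Z : C) where
  mid : C
  i : A ⟶ mid
  p : mid ⟶ Z

/-- Two sequences `A ⟶ X ⟶ Z` and `A ⟶ X' ⟶ Z` are equivalent if there is an isomorphism
`X ≅ X'` compatible with the identities of `A` and `Z`. -/
instance seqSetoid (A Z : C) : Setoid (Seq A Z) where
  r S S' := ∃ e : S.mid ≅ S'.mid, S.i ≫ e.hom = S'.i ∧ e.hom ≫ S'.p = S.p
  iseqv :=
    { refl := fun S => ⟨Iso.refl _, by simp, by simp⟩
      symm := by
        rintro S S' ⟨e, h₁, h₂⟩
        exact ⟨e.symm, by simp [← h₁], by simp [← h₂]⟩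
      trans := by
        rintro S S' S'' ⟨e, h₁, h₂⟩ ⟨e', h₁', h₂'⟩
        exact ⟨e ≪≫ e', by simp [← h₁', ← h₁], by simp [← h₂', ← h₂]⟩ }

/-- Equivalence classes of sequences `A ⟶ X ⟶ Z`. -/
def SeqClass (A Z : C) : Type (max u v) := Quotient (seqSetoid A Z)

/-- The class `[A ⟶ X ⟶ Z]`. -/
def SeqClass.mk {A X Z : C} (i : A ⟶ X) (p : X ⟶ Z) : SeqClass A Z :=
  Quotient.mk (seqSetoid A Z) ⟨X, i, p⟩

theorem SeqClass.mk_eq_mk_iff {A X X' Z : C} (i : A ⟶ X) (p : X ⟶ Z) (i' : A ⟶ X')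
    (p' : X' ⟶ Z) : SeqClass.mk i p = SeqClass.mk i' p' ↔
      ∃ e : X ≅ X', i ≫ e.hom = i' ∧ e.hom ≫ p' = p :=
  Quotient.eq (r := seqSetoid A Z)

/-- A chosen representative of a class of sequences. -/
noncomputable def SeqClass.rep {A Z : C} (q : SeqClass A Z) : Seq A Z :=
  Quotient.out (s := seqSetoid A Z) q

theorem SeqClass.mk_rep {A Z : C} (q : SeqClass A Z) : SeqClass.mk q.rep.i q.rep.p = q :=
  Quotient.out_eq (s := seqSetoid A Z) q

theorem SeqClass.exists_rep {A Z : C} (q : SeqClass A Z) :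
    ∃ (X : C) (i : A ⟶ X) (p : X ⟶ Z), q = SeqClass.mk i p := by
  induction q using Quotient.inductionOn with
  | h S => exact ⟨S.mid, S.i, S.p, rfl⟩

/-- `F([A ⟶ X ⟶ Z]) = [F A ⟶ F X ⟶ F Z]`. -/
def SeqClass.map (F : C ⥤ D) {A Z : C} (q : SeqClass A Z) : SeqClass (F.obj A) (F.obj Z) :=
  Quotient.map' (s₁ := seqSetoid A Z) (s₂ := seqSetoid (F.obj A) (F.obj Z))
    (fun S => ⟨F.obj S.mid, F.map S.i, F.map S.p⟩)
    (by
      rintro S S' ⟨e, h₁, h₂⟩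
      exact ⟨F.mapIso e, by simp [← h₁], by simp [← h₂]⟩) q

theorem SeqClass.map_mk (F : C ⥤ D) {A X Z : C} (i : A ⟶ X) (p : X ⟶ Z) :
    (SeqClass.mk i p).map F = SeqClass.mk (F.map i) (F.map p) := rfl

/-- The family of classes of sequences `q i`, seen as a class of sequences in `Fun(I, C)`. -/
noncomputable def SeqClass.pi {I : Type v₁} {A Z : Discrete I ⥤ C}
    (q : ∀ i : I, SeqClass (A.obj ⟨i⟩) (Z.obj ⟨i⟩)) : SeqClass A Z :=
  SeqClass.mk (X := Discrete.functor fun i => (q i).rep.mid)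
    (Discrete.natTrans fun i => (q i.as).rep.i) (Discrete.natTrans fun i => (q i.as).rep.p)

theorem SeqClass.pi_eq_mk_iff {I : Type v₁} {A X Z : Discrete I ⥤ C}
    (q : ∀ i : I, SeqClass (A.obj ⟨i⟩) (Z.obj ⟨i⟩)) (f : A ⟶ X) (g : X ⟶ Z) :
    SeqClass.pi q = SeqClass.mk f g ↔
      ∀ i : I, q i = SeqClass.mk (f.app ⟨i⟩) (g.app ⟨i⟩) := by
  constructor
  · intro h i
    obtain ⟨e, h₁, h₂⟩ := (SeqClass.mk_eq_mk_iff _ _ _ _).1 h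
    rw [← (q i).mk_rep, SeqClass.mk_eq_mk_iff]
    exact ⟨e.app ⟨i⟩, congrArg (fun t => t.app ⟨i⟩) h₁, congrArg (fun t => t.app ⟨i⟩) h₂⟩
  · intro h
    have h' : ∀ i : I, SeqClass.mk (q i).rep.i (q i).rep.p =
        SeqClass.mk (f.app ⟨i⟩) (g.app ⟨i⟩) := fun i => by rw [SeqClass.mk_rep, h i]
    choose e h₁ h₂ using fun i => (SeqClass.mk_eq_mk_iff _ _ _ _).1 (h' i)
    refine (SeqClass.mk_eq_mk_iff _ _ _ _).2
      ⟨Discrete.natIso fun i => e i.as, ?_, ?_⟩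
    · ext i
      exact h₁ i.as
    · ext i
      exact h₂ i.as

end Sequences

section Bifunctors

variable {C : Type u} [Category.{v} C]

/-- For a bifunctor `E : Cᵒᵖ × C ⥤ Ab`, the map `E(Z, A) → E(Z', A')`, `x ↦ a · x · c`, induced
by `c : Z' ⟶ Z` and `a : A ⟶ A'`. -/
def act (E : Cᵒᵖ × C ⥤ AddCommGrpCat.{w}) {Z Z' A A' : C} (c : Z' ⟶ Z) (a : A ⟶ A') :
    E.obj (op Z, A) →+ E.obj (op Z', A') :=
  (E.map (CategoryTheory.Prod.mkHom c.op a)).hom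

/-- The map `E(Z, A) → E(Z', A)`, `x ↦ x · c`. -/
def pull (E : Cᵒᵖ × C ⥤ AddCommGrpCat.{w}) {Z Z' : C} (c : Z' ⟶ Z) (A : C) :
    E.obj (op Z, A) →+ E.obj (op Z', A) :=
  act E c (𝟙 A)

/-- The map `E(Z, A) → E(Z, A')`, `x ↦ a · x`. -/
def push (E : Cᵒᵖ × C ⥤ AddCommGrpCat.{w}) (Z : C) {A A' : C} (a : A ⟶ A') :
    E.obj (op Z, A) →+ E.obj (op Z, A') :=
  act E (𝟙 Z) a

theorem act_comp (E : Cᵒᵖ × C ⥤ AddCommGrpCat.{w}) {Z Z' Z'' A A' A'' : C} (c : Z' ⟶ Z)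
    (a : A ⟶ A') (c' : Z'' ⟶ Z') (a' : A' ⟶ A'') (x : E.obj (op Z, A)) :
    act E c' a' (act E c a x) = act E (c' ≫ c) (a ≫ a') x := by
  have h := E.map_comp (CategoryTheory.Prod.mkHom c.op a) (CategoryTheory.Prod.mkHom c'.op a')
  exact (congrArg (fun f => f.hom x) h).symm

theorem act_id (E : Cᵒᵖ × C ⥤ AddCommGrpCat.{w}) {Z A : C} (x : E.obj (op Z, A)) :
    act E (𝟙 Z) (𝟙 A) x = x :=
  congrArg (fun f => f.hom x) (E.map_id (op Z, A))

/-- The bifunctor `∏ i, E((-)_i, (?)_i)` on the category `Fun(I, C)`. -/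
def piBifunctor (E : Cᵒᵖ × C ⥤ AddCommGrpCat.{w}) (I : Type v₁) :
    (Discrete I ⥤ C)ᵒᵖ × (Discrete I ⥤ C) ⥤ AddCommGrpCat.{max v₁ w} where
  obj P := AddCommGrpCat.of (∀ i : I, E.obj (op (P.1.unop.obj ⟨i⟩), P.2.obj ⟨i⟩))
  map f := AddCommGrpCat.ofHom (AddMonoidHom.pi fun i =>
    (act E (f.1.unop.app ⟨i⟩) (f.2.app ⟨i⟩)).comp (Pi.evalAddMonoidHom _ i))
  map_id P := by
    ext x i
    exact act_id E _
  map_comp f g := by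
    ext x i
    exact (act_comp E _ _ _ _ _).symm

theorem act_piBifunctor_apply (E : Cᵒᵖ × C ⥤ AddCommGrpCat.{w}) (I : Type v₁)
    {Z Z' A A' : Discrete I ⥤ C} (c : Z' ⟶ Z) (a : A ⟶ A')
    (x : (piBifunctor E I).obj (op Z, A)) (i : I) :
    act (piBifunctor E I) c a x i = act E (c.app ⟨i⟩) (a.app ⟨i⟩) (x i) := rfl

end Bifunctors

section Extriangulated

/-- An extriangulated category `(C, E, s)` in the sense of Nakaoka and Palu. -/
structure Extriangulated (C : Type u) [Category.{v} C] [Preadditive C] where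
  /-- `C` is additive. -/
  hasFiniteBiproducts : HasFiniteBiproducts C
  /-- The bifunctor of extensions. -/
  E : Cᵒᵖ × C ⥤ AddCommGrpCat.{w}
  /-- `E` is additive in the first variable. -/
  pull_add : ∀ {Z Z' A : C} (c c' : Z' ⟶ Z) (x : E.obj (op Z, A)),
    pull E (c + c') A x = pull E c A x + pull E c' A x
  /-- `E` is additive in the second variable. -/
  push_add : ∀ {Z A A' : C} (a a' : A ⟶ A') (x : E.obj (op Z, A)),
    push E Z (a + a') x = push E Z a x + push E Z a' x
  /-- The realization, which sends an extension in `E(Z, A)` to a class `[A ⟶ X ⟶ Z]`. -/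
  s : ∀ {Z A : C}, E.obj (op Z, A) → SeqClass A Z
  /-- Every morphism of extensions is realized by a morphism of sequences. -/
  exists_realization : ∀ {Z Z' A A' X X' : C} {x : E.obj (op Z, A)} {x' : E.obj (op Z', A')}
    {i : A ⟶ X} {p : X ⟶ Z} {i' : A' ⟶ X'} {p' : X' ⟶ Z'},
    s x = SeqClass.mk i p → s x' = SeqClass.mk i' p' →
    ∀ (a : A ⟶ A') (c : Z ⟶ Z'), push E Z a x = pull E c A' x' →
      ∃ b : X ⟶ X', i ≫ b = a ≫ i' ∧ b ≫ p' = p ≫ c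
  /-- The realization is additive: `s(0)` is the class of the split sequence. -/
  s_zero : ∀ {Z A : C} (b : BinaryBicone A Z), b.IsBilimit →
    s (0 : E.obj (op Z, A)) = SeqClass.mk b.inl b.snd
  /-- The realization is additive: `s(x ⊕ x') = s(x) ⊕ s(x')`. -/
  s_sum : ∀ {Z Z' A A' X X' : C} {x : E.obj (op Z, A)} {x' : E.obj (op Z', A')}
    {i : A ⟶ X} {p : X ⟶ Z} {i' : A' ⟶ X'} {p' : X' ⟶ Z'},
    s x = SeqClass.mk i p → s x' = SeqClass.mk i' p' →
    ∀ (bA : BinaryBicone A A') (bX : BinaryBicone X X') (bZ : BinaryBicone Z Z'),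
      bA.IsBilimit → bX.IsBilimit → bZ.IsBilimit →
      s (act E bZ.fst bA.inl x + act E bZ.snd bA.inr x') =
        SeqClass.mk (bA.fst ≫ i ≫ bX.inl + bA.snd ≫ i' ≫ bX.inr)
          (bX.fst ≫ p ≫ bZ.inl + bX.snd ≫ p' ≫ bZ.inr)
  /-- Axiom (ET3). -/
  et3 : ∀ {Z Z' A A' X X' : C} {x : E.obj (op Z, A)} {x' : E.obj (op Z', A')}
    {i : A ⟶ X} {p : X ⟶ Z} {i' : A' ⟶ X'} {p' : X' ⟶ Z'},
    s x = SeqClass.mk i p → s x' = SeqClass.mk i' p' →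
    ∀ (a : A ⟶ A') (b : X ⟶ X'), i ≫ b = a ≫ i' →
      ∃ c : Z ⟶ Z', b ≫ p' = p ≫ c ∧ push E Z a x = pull E c A' x'
  /-- Axiom (ET3)ᵒᵖ. -/
  et3_op : ∀ {Z Z' A A' X X' : C} {x : E.obj (op Z, A)} {x' : E.obj (op Z', A')}
    {i : A ⟶ X} {p : X ⟶ Z} {i' : A' ⟶ X'} {p' : X' ⟶ Z'},
    s x = SeqClass.mk i p → s x' = SeqClass.mk i' p' →
    ∀ (b : X ⟶ X') (c : Z ⟶ Z'), b ≫ p' = p ≫ c →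
      ∃ a : A ⟶ A', i ≫ b = a ≫ i' ∧ push E Z a x = pull E c A' x'
  /-- Axiom (ET4). -/
  et4 : ∀ {A B M D F : C} {x : E.obj (op D, A)} {y : E.obj (op F, B)}
    {f : A ⟶ B} {f' : B ⟶ D} {g : B ⟶ M} {g' : M ⟶ F},
    s x = SeqClass.mk f f' → s y = SeqClass.mk g g' →
    ∃ (N : C) (h' : M ⟶ N) (d : D ⟶ N) (e : N ⟶ F) (z : E.obj (op N, A)),
      s z = SeqClass.mk (f ≫ g) h' ∧ f' ≫ d = g ≫ h' ∧ h' ≫ e = g' ∧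
      s (push E F f' y) = SeqClass.mk d e ∧
      pull E d A z = x ∧ push E N f z = pull E e B y
  /-- Axiom (ET4)ᵒᵖ. -/
  et4_op : ∀ {A B M D F : C} {x : E.obj (op B, D)} {y : E.obj (op M, F)}
    {f' : D ⟶ A} {f : A ⟶ B} {g' : F ⟶ B} {g : B ⟶ M},
    s x = SeqClass.mk f' f → s y = SeqClass.mk g' g →
    ∃ (N : C) (h' : N ⟶ A) (d : D ⟶ N) (e : N ⟶ F) (z : E.obj (op M, N)),
      s z = SeqClass.mk h' (f ≫ g) ∧ d ≫ h' = f' ∧ h' ≫ f = e ≫ g' ∧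
      s (pull E g' D x) = SeqClass.mk d e ∧
      push E M e z = y ∧ push E B d x = pull E g N z

variable {C : Type u} [Category.{v} C] [Preadditive C]


theorem isBilimit_app {I : Type v₁} {F G : Discrete I ⥤ C} (b : BinaryBicone F G)
    (hb : b.IsBilimit) (i : Discrete I) :
    Nonempty ((((evaluation (Discrete I) C).obj i).mapBinaryBicone b).IsBilimit) := by
  refine ⟨isBinaryBilimitOfTotal _ ?_⟩
  have h := IsBilimit.binary_total hb
  exact congrArg (fun f => f.app i) h

/-- The extriangulated category `Fun(I, C)`, with `∏ i, E((-)_i, (?)_i)` as bifunctor and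
with the realization defined componentwise. -/
noncomputable def Extriangulated.pi (𝓒 : Extriangulated.{w} C) (I : Type v₁) :
    Extriangulated.{max v₁ w} (Discrete I ⥤ C) where
  hasFiniteBiproducts := by
    have := 𝓒.hasFiniteBiproducts
    exact HasFiniteBiproducts.of_hasFiniteProducts
  E := piBifunctor 𝓒.E I
  pull_add c c' x := by
    funext i
    exact 𝓒.pull_add _ _ _
  push_add a a' x := by
    funext i
    exact 𝓒.push_add _ _ _
  s x := SeqClass.pi fun i => 𝓒.s (x i)
  exists_realization {Z Z' A A' X X' x x' i p i' p'} h h' a c hac := by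
    rw [SeqClass.pi_eq_mk_iff] at h h'
    choose b h₁ h₂ using fun j => 𝓒.exists_realization (h j) (h' j) (a.app ⟨j⟩) (c.app ⟨j⟩)
      (congrFun hac j)
    refine ⟨Discrete.natTrans fun j => b j.as, ?_, ?_⟩
    · ext j
      exact h₁ j.as
    · ext j
      exact h₂ j.as
  s_zero b hb := by
    rw [SeqClass.pi_eq_mk_iff]
    intro j
    exact 𝓒.s_zero _ (isBilimit_app b hb ⟨j⟩).some
  s_sum h h' bA bX bZ hA hX hZ := by
    rw [SeqClass.pi_eq_mk_iff] at h h' ⊢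
    intro j
    exact 𝓒.s_sum (h j) (h' j) _ _ _ (isBilimit_app bA hA ⟨j⟩).some
      (isBilimit_app bX hX ⟨j⟩).some (isBilimit_app bZ hZ ⟨j⟩).some
  et3 h h' a b hab := by
    rw [SeqClass.pi_eq_mk_iff] at h h'
    choose c h₁ h₂ using fun j => 𝓒.et3 (h j) (h' j) (a.app ⟨j⟩) (b.app ⟨j⟩)
      (congrArg (fun t => t.app ⟨j⟩) hab)
    refine ⟨Discrete.natTrans fun j => c j.as, ?_, ?_⟩
    · ext j
      exact h₁ j.as
    · funext j
      exact h₂ j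
  et3_op h h' b c hbc := by
    rw [SeqClass.pi_eq_mk_iff] at h h'
    choose a h₁ h₂ using fun j => 𝓒.et3_op (h j) (h' j) (b.app ⟨j⟩) (c.app ⟨j⟩)
      (congrArg (fun t => t.app ⟨j⟩) hbc)
    refine ⟨Discrete.natTrans fun j => a j.as, ?_, ?_⟩
    · ext j
      exact h₁ j.as
    · funext j
      exact h₂ j
  et4 h h' := by
    rw [SeqClass.pi_eq_mk_iff] at h h'
    choose N k d e z h₁ h₂ h₃ h₄ h₅ h₆ using fun j => 𝓒.et4 (h j) (h' j)
    refine ⟨Discrete.functor N, Discrete.natTrans fun j => k j.as,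
      Discrete.natTrans fun j => d j.as, Discrete.natTrans fun j => e j.as, z,
      ?_, ?_, ?_, ?_, ?_, ?_⟩
    · rw [SeqClass.pi_eq_mk_iff]
      exact h₁
    · ext j
      exact h₂ j.as
    · ext j
      exact h₃ j.as
    · rw [SeqClass.pi_eq_mk_iff]
      exact h₄
    · funext j
      exact h₅ j
    · funext j
      exact h₆ j
  et4_op h h' := by
    rw [SeqClass.pi_eq_mk_iff] at h h'
    choose N k d e z h₁ h₂ h₃ h₄ h₅ h₆ using fun j => 𝓒.et4_op (h j) (h' j)
    refine ⟨Discrete.functor N, Discrete.natTrans fun j => k j.as,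
      Discrete.natTrans fun j => d j.as, Discrete.natTrans fun j => e j.as, z,
      ?_, ?_, ?_, ?_, ?_, ?_⟩
    · rw [SeqClass.pi_eq_mk_iff]
      exact h₁
    · ext j
      exact h₂ j.as
    · ext j
      exact h₃ j.as
    · rw [SeqClass.pi_eq_mk_iff]
      exact h₄
    · funext j
      exact h₅ j
    · funext j
      exact h₆ j

end Extriangulated

section Functors

variable {C : Type u} [Category.{v} C] [Preadditive C] {D : Type u₁} [Category.{v₁} D]
  [Preadditive D]

/-- The structure of an extriangulated functor on `T : C ⥤ D`. -/
structure ExtriangulatedFunctor (𝓒 : Extriangulated.{w} C) (𝓓 : Extriangulated.{w} D)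
    (T : C ⥤ D) where
  additive : T.Additive
  Γ : 𝓒.E ⟶ T.op.prod T ⋙ 𝓓.E
  s_Γ : ∀ {Z A : C} (x : 𝓒.E.obj (op Z, A)), 𝓓.s ((Γ.app (op Z, A)).hom x) = (𝓒.s x).map T

variable {X : Type u₂} [Category.{v₂} X] {Y : Type u₃} [Category.{v₃} Y]

/-- The structure of an `(S₁, S₂)`-extriangulated functor on `T : C ⥤ D`, where `S₁ : X ⥤ C`
and `S₂ : Y ⥤ C`. -/
structure ExtriangulatedAlong (𝓒 : Extriangulated.{w} C) (𝓓 : Extriangulated.{w} D)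
    (T : C ⥤ D) (S₁ : X ⥤ C) (S₂ : Y ⥤ C) where
  additive : T.Additive
  Γ : S₁.op.prod S₂ ⋙ 𝓒.E ⟶ (S₁ ⋙ T).op.prod (S₂ ⋙ T) ⋙ 𝓓.E
  s_Γ : ∀ {Z : X} {A : Y} (x : 𝓒.E.obj (op (S₁.obj Z), S₂.obj A)),
    𝓓.s ((Γ.app (op Z, A)).hom x) = (𝓒.s x).map T

/-- The identity functor is `(S₁, S₂)`-extriangulated, via the identity transformation. -/
def ExtriangulatedAlong.id (𝓒 : Extriangulated.{w} C) (S₁ : X ⥤ C) (S₂ : Y ⥤ C) :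
    ExtriangulatedAlong 𝓒 𝓒 (𝟭 C) S₁ S₂ where
  additive := inferInstance
  Γ := 𝟙 (S₁.op.prod S₂ ⋙ 𝓒.E)
  s_Γ {Z A} x := by
    obtain ⟨M, i, p, h⟩ := SeqClass.exists_rep (𝓒.s x)
    rw [h]
    exact h

/-- The composition of an `(S₁, S₂)`-extriangulated functor with an extriangulated functor. -/
def ExtriangulatedAlong.comp {B : Type*} [Category* B] [Preadditive B]
    {𝓒 : Extriangulated.{w} C} {𝓓 : Extriangulated.{w} D} {𝓑 : Extriangulated.{w} B}
    {T : C ⥤ D} {S₁ : X ⥤ C} {S₂ : Y ⥤ C} {U : D ⥤ B} (hT : ExtriangulatedAlong 𝓒 𝓓 T S₁ S₂)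
    (hU : ExtriangulatedFunctor 𝓓 𝓑 U) : ExtriangulatedAlong 𝓒 𝓑 (T ⋙ U) S₁ S₂ where
  additive := by
    have := hT.additive
    have := hU.additive
    infer_instance
  Γ := hT.Γ ≫ Functor.whiskerLeft ((S₁ ⋙ T).op.prod (S₂ ⋙ T)) hU.Γ
  s_Γ {Z A} x := by
    obtain ⟨M, i, p, h⟩ := SeqClass.exists_rep (𝓒.s x)
    refine (hU.s_Γ _).trans ?_
    refine (congrArg (SeqClass.map U) (hT.s_Γ x)).trans ?_
    rw [h]
    rfl

/-- A natural transformation `α : T ⟶ T'` is a natural transformation of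
`(S₁, S₂)`-extriangulated functors if `α_{S₂ A} · Γ_T(x) = Γ_{T'}(x) · α_{S₁ Z}` for every
`x ∈ E(S₁ Z, S₂ A)`. -/
def IsExtriangulatedTrans {𝓒 : Extriangulated.{w} C} {𝓓 : Extriangulated.{w} D}
    {T T' : C ⥤ D} {S₁ : X ⥤ C} {S₂ : Y ⥤ C} (α : T ⟶ T')
    (hT : ExtriangulatedAlong 𝓒 𝓓 T S₁ S₂) (hT' : ExtriangulatedAlong 𝓒 𝓓 T' S₁ S₂) : Prop :=
  ∀ (Z : X) (A : Y) (x : 𝓒.E.obj (op (S₁.obj Z), S₂.obj A)),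
    push 𝓓.E (T.obj (S₁.obj Z)) (α.app (S₂.obj A)) ((hT.Γ.app (op Z, A)).hom x) =
      pull 𝓓.E (α.app (S₁.obj Z)) (T'.obj (S₂.obj A)) ((hT'.Γ.app (op Z, A)).hom x)

end Functors

section Coproducts

variable {C : Type u} [Category.{v} C] [Preadditive C]

/-- The constant functor `C ⥤ Fun(I, C)` is extriangulated, via `x ↦ (x)_i`. -/
noncomputable def constExtriangulated (𝓒 : Extriangulated.{max v w} C) (I : Type v) :
    ExtriangulatedFunctor 𝓒 (𝓒.pi I) (Functor.const (Discrete I)) where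
  additive := { map_add := rfl }
  Γ :=
    { app := fun _ => AddCommGrpCat.ofHom (AddMonoidHom.pi fun _ => AddMonoidHom.id _)
      naturality := fun P Q f => by
        ext x
        rfl }
  s_Γ {Z A} x := by
    obtain ⟨M, i, p, h⟩ := SeqClass.exists_rep (𝓒.s x)
    rw [h]
    exact (SeqClass.pi_eq_mk_iff _ _ _).2 fun j => h

/-- AET3.5(`I`): coproducts indexed by `I` exist, and `∐ : Fun(I, C) ⥤ C` is
`(1, T)`-extriangulated, where `T` is the constant functor. -/
def AET35On (𝓒 : Extriangulated.{max v w} C) (I : Type v) : Prop :=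
  ∃ _ : HasCoproductsOfShape I C,
    Nonempty (ExtriangulatedAlong (𝓒.pi I) 𝓒 (colim : (Discrete I ⥤ C) ⥤ C)
      (𝟭 (Discrete I ⥤ C)) (Functor.const (Discrete I)))

/-- AET4(`I`): coproducts indexed by `I` exist, `∐ : Fun(I, C) ⥤ C` is
`(1, T)`-extriangulated, where `T` is the constant functor, and the canonical inclusions
`X ⟶ T (∐ X)` are a natural transformation of `(1, T)`-extriangulated functors. -/
def AET4On (𝓒 : Extriangulated.{max v w} C) (I : Type v) : Prop :=
  ∃ (_ : HasCoproductsOfShape I C)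
    (hS : ExtriangulatedAlong (𝓒.pi I) 𝓒 (colim : (Discrete I ⥤ C) ⥤ C)
      (𝟭 (Discrete I ⥤ C)) (Functor.const (Discrete I))),
    IsExtriangulatedTrans (colimConstAdj (J := Discrete I) (C := C)).unit
      (ExtriangulatedAlong.id (𝓒.pi I) _ _) (hS.comp (constExtriangulated 𝓒 I))

/-- AET3.5: AET3.5(`I`) holds for every non-empty set `I`. -/
def IsAET35 (𝓒 : Extriangulated.{max v w} C) : Prop :=
  ∀ (I : Type v) [Nonempty I], AET35On.{w} 𝓒 I

/-- AET4: AET4(`I`) holds for every non-empty set `I`. -/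
def IsAET4 (𝓒 : Extriangulated.{max v w} C) : Prop :=
  ∀ (I : Type v) [Nonempty I], AET4On.{w} 𝓒 I

/-- The natural transformation `G(∐ Z_i, A) → ∏ G(Z_i, A)`, `x ↦ (x · μ_i)_i`, where `μ_i` are
the canonical inclusions, for a bifunctor `G`. -/
noncomputable def tau {C : Type u} [Category.{v} C] (G : Cᵒᵖ × C ⥤ AddCommGrpCat.{max v w})
    (I : Type v) [HasCoproductsOfShape I C] :
    (colim : (Discrete I ⥤ C) ⥤ C).op.prod (𝟭 C) ⋙ G ⟶
      (𝟭 (Discrete I ⥤ C)).op.prod (Functor.const (Discrete I)) ⋙ piBifunctor G I where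
  app P := AddCommGrpCat.ofHom (AddMonoidHom.pi fun i => pull G (colimit.ι P.1.unop ⟨i⟩) P.2)
  naturality P Q f := by
    ext x
    refine funext fun i => ?_
    refine (act_comp G _ _ _ _ _).trans (Eq.trans ?_ (act_comp G _ _ _ _ _).symm)
    congr 2
    · exact ι_colimMap _ _
    · simp

end Coproducts

section Exact

variable {C : Type u} [Category.{v} C] [Preadditive C]

/-- `f` is an inflation for the class `conf` of short complexes. -/
def IsInflation (conf : ShortComplex C → Prop) {A X : C} (f : A ⟶ X) : Prop :=
  ∃ (Z : C) (g : X ⟶ Z) (w : f ≫ g = 0), conf (ShortComplex.mk f g w)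

/-- `g` is a deflation for the class `conf` of short complexes. -/
def IsDeflation (conf : ShortComplex C → Prop) {X Z : C} (g : X ⟶ Z) : Prop :=
  ∃ (A : C) (f : A ⟶ X) (w : f ≫ g = 0), conf (ShortComplex.mk f g w)

/-- The structure of an exact category in the sense of Quillen on an additive category `C`:
a class of kernel-cokernel pairs, the conflations. -/
structure ExactStructure (C : Type u) [Category.{v} C] [Preadditive C] where
  conf : ShortComplex C → Prop
  kernel : ∀ {S : ShortComplex C}, conf S → Nonempty (IsLimit (KernelFork.ofι S.f S.zero))
  cokernel : ∀ {S : ShortComplex C}, conf S → Nonempty (IsColimit (CokernelCofork.ofπ S.g S.zero))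
  of_iso : ∀ {S S' : ShortComplex C}, conf S → (S ≅ S') → conf S'
  id_inflation : ∀ A : C, IsInflation conf (𝟙 A)
  id_deflation : ∀ A : C, IsDeflation conf (𝟙 A)
  comp_inflation : ∀ {A B D : C} (f : A ⟶ B) (g : B ⟶ D),
    IsInflation conf f → IsInflation conf g → IsInflation conf (f ≫ g)
  comp_deflation : ∀ {A B D : C} (f : A ⟶ B) (g : B ⟶ D),
    IsDeflation conf f → IsDeflation conf g → IsDeflation conf (f ≫ g)
  /-- The pushout of an inflation along any morphism exists and is an inflation. -/
  pushout : ∀ {A X A' : C} (f : A ⟶ X) (a : A ⟶ A'), IsInflation conf f →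
    ∃ (P : C) (b : X ⟶ P) (f' : A' ⟶ P), IsPushout f a b f' ∧ IsInflation conf f'
  /-- The pullback of a deflation along any morphism exists and is a deflation. -/
  pullback : ∀ {X Z Z' : C} (g : X ⟶ Z) (c : Z' ⟶ Z), IsDeflation conf g →
    ∃ (P : C) (b : P ⟶ X) (g' : P ⟶ Z'), IsPullback b g' g c ∧ IsDeflation conf g'

namespace ExactStructure

variable (𝓔 : ExactStructure C)

/-- `A ⟶ X ⟶ Z` is a conflation. -/
def Conf {A X Z : C} (i : A ⟶ X) (p : X ⟶ Z) : Prop :=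
  ∃ w : i ≫ p = 0, 𝓔.conf (ShortComplex.mk i p w)

variable {𝓔}

section Basic

variable {A X Z : C} {i : A ⟶ X} {p : X ⟶ Z}

theorem Conf.zero (h : 𝓔.Conf i p) : i ≫ p = 0 := h.1

theorem Conf.inflation (h : 𝓔.Conf i p) : IsInflation 𝓔.conf i := ⟨Z, p, h.1, h.2⟩

theorem Conf.deflation (h : 𝓔.Conf i p) : IsDeflation 𝓔.conf p := ⟨A, i, h.1, h.2⟩

theorem Conf.mono (h : 𝓔.Conf i p) : Mono i :=
  mono_of_isLimit_fork (𝓔.kernel h.2).some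

theorem Conf.epi (h : 𝓔.Conf i p) : Epi p :=
  epi_of_isColimit_cofork (𝓔.cokernel h.2).some

theorem Conf.lift (h : 𝓔.Conf i p) {T : C} (t : T ⟶ X) (ht : t ≫ p = 0) :
    ∃ l : T ⟶ A, l ≫ i = t :=
  ⟨_, (KernelFork.IsLimit.lift' (𝓔.kernel h.2).some t ht).2⟩

theorem Conf.desc (h : 𝓔.Conf i p) {T : C} (t : X ⟶ T) (ht : i ≫ t = 0) :
    ∃ l : Z ⟶ T, p ≫ l = t :=
  ⟨_, (CokernelCofork.IsColimit.desc' (𝓔.cokernel h.2).some t ht).2⟩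

theorem Conf.iso (h : 𝓔.Conf i p) {A' X' Z' : C} {i' : A' ⟶ X'} {p' : X' ⟶ Z'} (eA : A ≅ A')
    (eX : X ≅ X') (eZ : Z ≅ Z') (h₁ : i ≫ eX.hom = eA.hom ≫ i')
    (h₂ : p ≫ eZ.hom = eX.hom ≫ p') : 𝓔.Conf i' p' := by
  have w : i' ≫ p' = 0 := by
    rw [← cancel_epi eA.hom, ← Category.assoc, ← h₁, Category.assoc, ← h₂, ← Category.assoc, h.1]
    simp
  exact ⟨w, 𝓔.of_iso h.2 (ShortComplex.isoMk eA eX eZ h₁.symm h₂.symm)⟩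

/-- A deflation together with a kernel of it is a conflation. -/
theorem conf_of_deflation (hp : IsDeflation 𝓔.conf p) (w : i ≫ p = 0) [Mono i]
    (hi : ∀ (T : C) (t : T ⟶ X), t ≫ p = 0 → ∃ l : T ⟶ A, l ≫ i = t) : 𝓔.Conf i p := by
  obtain ⟨A', i', w', h⟩ := hp
  have h : 𝓔.Conf i' p := ⟨w', h⟩
  have := h.mono
  obtain ⟨l, hl⟩ := hi _ i' w'
  obtain ⟨l', hl'⟩ := h.lift i w
  refine h.iso ⟨l, l', ?_, ?_⟩ (Iso.refl _) (Iso.refl _) (by simp [hl]) (by simp)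
  · rw [← cancel_mono i', Category.assoc, hl', hl, Category.id_comp]
  · rw [← cancel_mono i, Category.assoc, hl, hl', Category.id_comp]

/-- An inflation together with a cokernel of it is a conflation. -/
theorem conf_of_inflation (hi : IsInflation 𝓔.conf i) (w : i ≫ p = 0) [Epi p]
    (hp : ∀ (T : C) (t : X ⟶ T), i ≫ t = 0 → ∃ l : Z ⟶ T, p ≫ l = t) : 𝓔.Conf i p := by
  obtain ⟨Z', p', w', h⟩ := hi
  have h : 𝓔.Conf i p' := ⟨w', h⟩
  have := h.epi
  obtain ⟨l, hl⟩ := hp _ p' w'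
  obtain ⟨l', hl'⟩ := h.desc p w
  refine h.iso (Iso.refl _) (Iso.refl _) ⟨l', l, ?_, ?_⟩ (by simp) (by simp [hl'])
  · rw [← cancel_epi p', ← Category.assoc, hl', hl, Category.comp_id]
  · rw [← cancel_epi p, ← Category.assoc, hl, hl', Category.comp_id]

theorem deflation_of_isPullback {P Z' : C} {b : P ⟶ X} {g : P ⟶ Z'} {c : Z' ⟶ Z}
    (h : IsPullback b g p c) (hp : IsDeflation 𝓔.conf p) : IsDeflation 𝓔.conf g := by
  obtain ⟨P', b', g', h', A', f, w, hf⟩ := 𝓔.pullback p c hp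
  have hf : 𝓔.Conf f g' := ⟨w, hf⟩
  have e := h'.isoIsPullback _ _ h
  refine (hf.iso (i' := f ≫ (h'.isoIsPullback _ _ h).hom) (Iso.refl _)
    (h'.isoIsPullback _ _ h) (Iso.refl _) (by simp) (by simp)).deflation

/-- The pullback of a conflation. -/
theorem Conf.exists_pullback (h : 𝓔.Conf i p) {Z' : C} (c : Z' ⟶ Z) :
    ∃ (P : C) (b : P ⟶ X) (j : A ⟶ P) (q : P ⟶ Z'), IsPullback b q p c ∧ j ≫ b = i ∧
      𝓔.Conf j q := by
  obtain ⟨P, b, q, hP, hq⟩ := 𝓔.pullback p c h.deflation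
  have := h.mono
  have hj := hP.lift_fst i 0 (by rw [h.zero, zero_comp])
  have hj' := hP.lift_snd i 0 (by rw [h.zero, zero_comp])
  set j := hP.lift i 0 (by rw [h.zero, zero_comp])
  have : Mono j := by
    have : Mono (j ≫ b) := by rw [hj]; infer_instance
    exact mono_of_mono j b
  refine ⟨P, b, j, q, hP, hj, conf_of_deflation hq hj' fun T t ht => ?_⟩
  obtain ⟨l, hl⟩ := h.lift (t ≫ b) (by rw [Category.assoc, hP.w, ← Category.assoc, ht, zero_comp])
  refine ⟨l, hP.hom_ext ?_ ?_⟩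
  · rw [Category.assoc, hj, hl]
  · rw [Category.assoc, hj', ht, comp_zero]

/-- The pushout of a conflation. -/
theorem Conf.exists_pushout (h : 𝓔.Conf i p) {A' : C} (a : A ⟶ A') :
    ∃ (P : C) (b : X ⟶ P) (j : A' ⟶ P) (q : P ⟶ Z), IsPushout i a b j ∧ b ≫ q = p ∧
      𝓔.Conf j q := by
  obtain ⟨P, b, j, hP, hj⟩ := 𝓔.pushout i a h.inflation
  have := h.epi
  have hq := hP.inl_desc p 0 (by rw [h.zero, comp_zero])
  have hq' := hP.inr_desc p 0 (by rw [h.zero, comp_zero])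
  set q := hP.desc p 0 (by rw [h.zero, comp_zero])
  have : Epi q := by
    have : Epi (b ≫ q) := by rw [hq]; infer_instance
    exact epi_of_epi b q
  refine ⟨P, b, j, q, hP, hq, conf_of_inflation hj hq' fun T t ht => ?_⟩
  obtain ⟨l, hl⟩ := h.desc (b ≫ t) (by rw [← Category.assoc, hP.w, Category.assoc, ht, comp_zero])
  refine ⟨l, hP.hom_ext ?_ ?_⟩
  · rw [← Category.assoc, hq, hl]
  · rw [← Category.assoc, hq', ht, zero_comp]

/-- The short five lemma for conflations with the same ends. -/
theorem Conf.isIso (h : 𝓔.Conf i p) {X' : C} {i' : A ⟶ X'} {p' : X' ⟶ Z} (h' : 𝓔.Conf i' p')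
    (b : X ⟶ X') (hi : i ≫ b = i') (hp : b ≫ p' = p) : IsIso b := by
  have := h.mono
  have := h'.mono
  have := h'.epi
  have hb : Mono b := by
    refine Preadditive.mono_of_cancel_zero b fun {T} t ht => ?_
    obtain ⟨l, rfl⟩ := h.lift t (by rw [← hp, ← Category.assoc, ht, zero_comp])
    have hl : l ≫ i' = 0 := by rw [← hi, ← Category.assoc, ht]
    rw [(cancel_mono i').1 (hl.trans zero_comp.symm), zero_comp]
  obtain ⟨P, q₁, j₁, q₂, hP, hj₁, hc⟩ := h.exists_pullback p'
  have := hc.epi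
  obtain ⟨j₂, hj₂, hj₂'⟩ : ∃ j₂ : A ⟶ P, j₂ ≫ q₁ = 0 ∧ j₂ ≫ q₂ = i' :=
    ⟨hP.lift 0 i' (by rw [h'.zero, zero_comp]), hP.lift_fst _ _ _, hP.lift_snd _ _ _⟩
  obtain ⟨s, hs, hs'⟩ : ∃ s : X ⟶ P, s ≫ q₁ = 𝟙 X ∧ s ≫ q₂ = b :=
    ⟨hP.lift (𝟙 X) b (by rw [hp, Category.id_comp]), hP.lift_fst _ _ _, hP.lift_snd _ _ _⟩
  obtain ⟨r, hr⟩ : ∃ r : P ⟶ A, q₁ ≫ s + r ≫ j₂ = 𝟙 P := by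
    obtain ⟨r, hr⟩ := h'.lift (q₂ - q₁ ≫ b) (by
      rw [Preadditive.sub_comp, Category.assoc, hp, ← hP.w, sub_self])
    refine ⟨r, hP.hom_ext ?_ ?_⟩
    · simp [hs, hj₂]
    · simp [hs', hj₂', hr]
  have hq₂ : (q₁ + r ≫ i) ≫ b = q₂ := by
    have := congrArg (· ≫ q₂) hr
    simp only [Preadditive.add_comp, Category.assoc, hs', hj₂', Category.id_comp] at this
    rw [Preadditive.add_comp, Category.assoc, hi, this]
  obtain ⟨e, he⟩ := hc.desc (q₁ + r ≫ i) (by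
    rw [← cancel_mono b, Category.assoc, hq₂, hc.zero, zero_comp])
  have heb : e ≫ b = 𝟙 X' := by
    rw [← cancel_epi q₂, ← Category.assoc, he, hq₂, Category.comp_id]
  exact ⟨e, by rw [← cancel_mono b, Category.assoc, heb, Category.comp_id, Category.id_comp], heb⟩

end Basic

section Sum

/-- A deflation remains a deflation after adding the identity of an object. -/
theorem deflation_sum_left {X X' Z : C} {p : X ⟶ Z} (hp : IsDeflation 𝓔.conf p)
    {b : BinaryBicone X X'} (hb : b.IsBilimit) {b' : BinaryBicone Z X'} (hb' : b'.IsBilimit) :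
    IsDeflation 𝓔.conf (b.fst ≫ p ≫ b'.inl + b.snd ≫ b'.inr) := by
  have h₁ := IsBilimit.binary_total hb
  have h₂ := IsBilimit.binary_total hb'
  refine deflation_of_isPullback (b := b.fst) (c := b'.fst) (p := p) ⟨⟨by simp⟩,
    ⟨PullbackCone.IsLimit.mk _ (fun s => s.fst ≫ b.inl + s.snd ≫ b'.snd ≫ b.inr) ?_ ?_ ?_⟩⟩ hp
  · intro s
    simp
  · intro s
    simp [reassoc_of% s.condition]
    simpa using congrArg (s.snd ≫ ·) h₂
  · intro s m hm hm'
    have := congrArg (m ≫ ·) h₁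
    simp only [Preadditive.comp_add, Category.comp_id, ← Category.assoc] at this
    rw [← this, hm, ← hm']
    simp

theorem deflation_sum_right {X X' Z : C} {p : X ⟶ Z} (hp : IsDeflation 𝓔.conf p)
    {b : BinaryBicone X' X} (hb : b.IsBilimit) {b' : BinaryBicone X' Z} (hb' : b'.IsBilimit) :
    IsDeflation 𝓔.conf (b.fst ≫ b'.inl + b.snd ≫ p ≫ b'.inr) := by
  have h₁ := IsBilimit.binary_total hb
  have h₂ := IsBilimit.binary_total hb'
  refine deflation_of_isPullback (b := b.snd) (c := b'.snd) (p := p) ⟨⟨by simp⟩,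
    ⟨PullbackCone.IsLimit.mk _ (fun s => s.fst ≫ b.inr + s.snd ≫ b'.fst ≫ b.inl) ?_ ?_ ?_⟩⟩ hp
  · intro s
    simp
  · intro s
    simp [reassoc_of% s.condition]
    simpa using congrArg (s.snd ≫ ·) h₂
  · intro s m hm hm'
    have := congrArg (m ≫ ·) h₁
    simp only [Preadditive.comp_add, Category.comp_id, ← Category.assoc] at this
    rw [← this, hm, ← hm', add_comm]
    simp

variable [HasBinaryBiproducts C]

/-- The direct sum of two conflations is a conflation. -/
theorem Conf.sum {A A' X X' Z Z' : C} {i : A ⟶ X} {p : X ⟶ Z} {i' : A' ⟶ X'} {p' : X' ⟶ Z'}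
    (h : 𝓔.Conf i p) (h' : 𝓔.Conf i' p') {bA : BinaryBicone A A'} {bX : BinaryBicone X X'}
    {bZ : BinaryBicone Z Z'} (hA : bA.IsBilimit) (hX : bX.IsBilimit) (hZ : bZ.IsBilimit) :
    𝓔.Conf (bA.fst ≫ i ≫ bX.inl + bA.snd ≫ i' ≫ bX.inr)
      (bX.fst ≫ p ≫ bZ.inl + bX.snd ≫ p' ≫ bZ.inr) := by
  have hb := BinaryBiproduct.isBilimit Z X'
  have hd := 𝓔.comp_deflation _ _ (deflation_sum_left h.deflation hX hb)
    (deflation_sum_right h'.deflation hb hZ)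
  have hd' : IsDeflation 𝓔.conf (bX.fst ≫ p ≫ bZ.inl + bX.snd ≫ p' ≫ bZ.inr) := by
    simpa using hd
  have := h.mono
  have := h'.mono
  have tA := IsBilimit.binary_total hA
  have tX := IsBilimit.binary_total hX
  have : Mono (bA.fst ≫ i ≫ bX.inl + bA.snd ≫ i' ≫ bX.inr) := by
    refine Preadditive.mono_of_cancel_zero _ fun {T} t ht => ?_
    have h₁ := congrArg (· ≫ bX.fst) ht
    have h₂ := congrArg (· ≫ bX.snd) ht
    simp at h₁ h₂
    have h₁ : t ≫ bA.fst = 0 := by rw [← cancel_mono i]; simpa using h₁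
    have h₂ : t ≫ bA.snd = 0 := by rw [← cancel_mono i']; simpa using h₂
    have := congrArg (t ≫ ·) tA
    simp only [Preadditive.comp_add, Category.comp_id, ← Category.assoc, h₁, h₂] at this
    simpa using this.symm
  refine conf_of_deflation hd' (by simp [reassoc_of% h.zero, reassoc_of% h'.zero]) fun T t ht => ?_
  have h₁ := congrArg (· ≫ bZ.fst) ht
  have h₂ := congrArg (· ≫ bZ.snd) ht
  obtain ⟨l, hl⟩ := h.lift (t ≫ bX.fst) (by simpa using h₁)
  obtain ⟨l', hl'⟩ := h'.lift (t ≫ bX.snd) (by simpa using h₂)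
  refine ⟨l ≫ bA.inl + l' ≫ bA.inr, ?_⟩
  have := congrArg (t ≫ ·) tX
  simp only [Preadditive.comp_add, Category.comp_id, ← Category.assoc, ← hl, ← hl'] at this
  simpa using this

/-- Split sequences are conflations. -/
theorem conf_split {A Z : C} (b : BinaryBicone A Z) (hb : b.IsBilimit) :
    𝓔.Conf b.inl b.snd := by
  obtain ⟨K, k, w, hk⟩ := 𝓔.id_inflation A
  have hk : 𝓔.Conf (𝟙 A) k := ⟨w, hk⟩
  obtain ⟨L, l, w', hl⟩ := 𝓔.id_deflation Z
  have hl : 𝓔.Conf l (𝟙 Z) := ⟨w', hl⟩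
  have hk0 : k = 0 := by simpa using w
  have hl0 : l = 0 := by simpa using w'
  have hK : 𝟙 K = 0 := by
    have := hk.epi
    rw [← cancel_epi k, hk0, zero_comp, zero_comp]
  have hL : 𝟙 L = 0 := by
    have := hl.mono
    rw [← cancel_mono l, hl0, comp_zero, comp_zero]
  have hs := hk.sum hl (BinaryBiproduct.isBilimit A L) hb (BinaryBiproduct.isBilimit K Z)
  have tA : biprod.snd ≫ biprod.inr = (0 : A ⊞ L ⟶ A ⊞ L) := by
    rw [← Category.id_comp (biprod.inr : L ⟶ A ⊞ L), hL]; simp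
  have tZ : biprod.fst ≫ biprod.inl = (0 : K ⊞ Z ⟶ K ⊞ Z) := by
    rw [← Category.id_comp (biprod.inl : K ⟶ K ⊞ Z), hK]; simp
  refine hs.iso (⟨biprod.fst, biprod.inl, ?_, by simp⟩ : A ⊞ L ≅ A) (Iso.refl _)
    (⟨biprod.snd, biprod.inr, ?_, by simp⟩ : K ⊞ Z ≅ Z) ?_ ?_
  · have := biprod.total (X := A) (Y := L)
    rwa [tA, add_zero] at this
  · have := biprod.total (X := K) (Y := Z)
    rwa [tZ, zero_add] at this
  · simp [hl0]
  · simp [hk0]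

end Sum

end ExactStructure

end Exact
namespace ExactStructure

section ExtGroups

variable {C : Type u} [Category.{v} C] [Preadditive C] (𝓔 : ExactStructure C)

/-- `Ext(Z, A)`: the equivalence classes of conflations `A ⟶ X ⟶ Z`. -/
def Ext (Z A : C) : Type (max u v) :=
  {q : SeqClass A Z // ∃ (X : C) (i : A ⟶ X) (p : X ⟶ Z), 𝓔.Conf i p ∧ q = SeqClass.mk i p}

/-- The exact category is Ext-small if the equivalence classes of conflations between any two
objects form a set. -/
def IsExtSmall : Prop := ∀ Z A : C, Small.{v} (𝓔.Ext Z A)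

variable {𝓔}

/-- The class of a conflation. -/
def Conf.ext {A X Z : C} {i : A ⟶ X} {p : X ⟶ Z} (h : 𝓔.Conf i p) : 𝓔.Ext Z A :=
  ⟨SeqClass.mk i p, X, i, p, h, rfl⟩

theorem Ext.exists_rep {Z A : C} (x : 𝓔.Ext Z A) :
    ∃ (X : C) (i : A ⟶ X) (p : X ⟶ Z) (h : 𝓔.Conf i p), x = h.ext := by
  obtain ⟨q, X, i, p, h, rfl⟩ := x
  exact ⟨X, i, p, h, rfl⟩

theorem Conf.ext_eq_iff {A X X' Z : C} {i : A ⟶ X} {p : X ⟶ Z} (h : 𝓔.Conf i p) {i' : A ⟶ X'}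
    {p' : X' ⟶ Z} (h' : 𝓔.Conf i' p') :
    h.ext = h'.ext ↔ ∃ e : X ≅ X', i ≫ e.hom = i' ∧ e.hom ≫ p' = p :=
  Subtype.ext_iff.trans (SeqClass.mk_eq_mk_iff i p i' p')

theorem Ext.exists_conf {A X Z : C} {i : A ⟶ X} {p : X ⟶ Z} {x : 𝓔.Ext Z A}
    (hx : x.1 = SeqClass.mk i p) : ∃ h : 𝓔.Conf i p, x = h.ext := by
  obtain ⟨X', i', p', h, rfl⟩ := x.exists_rep
  obtain ⟨e, h₁, h₂⟩ := (SeqClass.mk_eq_mk_iff _ _ _ _).1 hx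
  exact ⟨h.iso (Iso.refl _) e (Iso.refl _) (by simp [h₁]) (by simp [h₂]), Subtype.ext hx⟩

/-- `Mor a c x y` means that there is a morphism from a conflation in the class `x` to a
conflation in the class `y` which is `a` and `c` on the ends. -/
def Mor {Z Z' A A' : C} (a : A ⟶ A') (c : Z ⟶ Z') (x : 𝓔.Ext Z A) (y : 𝓔.Ext Z' A') : Prop :=
  ∃ (X X' : C) (i : A ⟶ X) (p : X ⟶ Z) (i' : A' ⟶ X') (p' : X' ⟶ Z') (b : X ⟶ X'),
    x.1 = SeqClass.mk i p ∧ y.1 = SeqClass.mk i' p' ∧ i ≫ b = a ≫ i' ∧ b ≫ p' = p ≫ c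

theorem mor_iff {Z Z' A A' X X' : C} {a : A ⟶ A'} {c : Z ⟶ Z'} {i : A ⟶ X} {p : X ⟶ Z}
    {i' : A' ⟶ X'} {p' : X' ⟶ Z'} {x : 𝓔.Ext Z A} {y : 𝓔.Ext Z' A'} (hx : x.1 = SeqClass.mk i p)
    (hy : y.1 = SeqClass.mk i' p') :
    Mor a c x y ↔ ∃ b : X ⟶ X', i ≫ b = a ≫ i' ∧ b ≫ p' = p ≫ c := by
  constructor
  · rintro ⟨X₁, X₁', i₁, p₁, i₁', p₁', b, hx₁, hy₁, h₁, h₂⟩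
    obtain ⟨e, he, he'⟩ := (SeqClass.mk_eq_mk_iff _ _ _ _).1 (hx.symm.trans hx₁)
    obtain ⟨f, hf, hf'⟩ := (SeqClass.mk_eq_mk_iff _ _ _ _).1 (hy₁.symm.trans hy)
    refine ⟨e.hom ≫ b ≫ f.hom, ?_, ?_⟩
    · rw [← hf, reassoc_of% he, reassoc_of% h₁]
    · rw [Category.assoc, Category.assoc, hf', h₂, reassoc_of% he']
  · rintro ⟨b, h₁, h₂⟩
    exact ⟨X, X', i, p, i', p', b, hx, hy, h₁, h₂⟩

theorem Mor.refl {Z A : C} (x : 𝓔.Ext Z A) : Mor (𝟙 A) (𝟙 Z) x x := by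
  obtain ⟨X, i, p, h, rfl⟩ := x.exists_rep
  exact (mor_iff rfl rfl).2 ⟨𝟙 X, by simp, by simp⟩

theorem Mor.eq {Z A : C} {x y : 𝓔.Ext Z A} (hxy : Mor (𝟙 A) (𝟙 Z) x y) : x = y := by
  obtain ⟨X, i, p, h, rfl⟩ := x.exists_rep
  obtain ⟨X', i', p', h', rfl⟩ := y.exists_rep
  obtain ⟨b, h₁, h₂⟩ := (mor_iff rfl rfl).1 hxy
  rw [Category.id_comp] at h₁
  rw [Category.comp_id] at h₂
  have := h.isIso h' b h₁ h₂
  exact (h.ext_eq_iff h').2 ⟨asIso b, h₁, h₂⟩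

theorem Mor.comp {Z Z' Z'' A A' A'' : C} {a : A ⟶ A'} {c : Z ⟶ Z'} {a' : A' ⟶ A''}
    {c' : Z' ⟶ Z''} {x : 𝓔.Ext Z A} {y : 𝓔.Ext Z' A'} {z : 𝓔.Ext Z'' A''} (h : Mor a c x y)
    (h' : Mor a' c' y z) : Mor (a ≫ a') (c ≫ c') x z := by
  obtain ⟨X, i, p, hx, rfl⟩ := x.exists_rep
  obtain ⟨X', i', p', hx', rfl⟩ := y.exists_rep
  obtain ⟨X'', i'', p'', hx'', rfl⟩ := z.exists_rep
  obtain ⟨b, h₁, h₂⟩ := (mor_iff rfl rfl).1 h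
  obtain ⟨b', h₁', h₂'⟩ := (mor_iff rfl rfl).1 h'
  refine (mor_iff rfl rfl).2 ⟨b ≫ b', ?_, ?_⟩
  · rw [reassoc_of% h₁, h₁', Category.assoc]
  · rw [Category.assoc, h₂', reassoc_of% h₂]

theorem exists_pullExt {Z Z' A : C} (c : Z' ⟶ Z) (x : 𝓔.Ext Z A) :
    ∃ y : 𝓔.Ext Z' A, Mor (𝟙 A) c y x ∧ ∀ {T B : C} (a : B ⟶ A) (d : T ⟶ Z') (t : 𝓔.Ext T B),
      Mor a (d ≫ c) t x → Mor a d t y := by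
  obtain ⟨X, i, p, h, rfl⟩ := x.exists_rep
  obtain ⟨P, b, j, q, hP, hj, hc⟩ := h.exists_pullback c
  refine ⟨hc.ext, (mor_iff rfl rfl).2 ⟨b, by simp [hj], hP.w⟩, fun {T B} a d t ht => ?_⟩
  obtain ⟨Y, k, r, ht', rfl⟩ := t.exists_rep
  obtain ⟨m, h₁, h₂⟩ := (mor_iff rfl rfl).1 ht
  refine (mor_iff rfl rfl).2 ⟨hP.lift m (r ≫ d) (by rw [h₂, Category.assoc]), hP.hom_ext ?_ ?_, ?_⟩
  · rw [Category.assoc, hP.lift_fst, h₁, Category.assoc, hj]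
  · rw [Category.assoc, hP.lift_snd, reassoc_of% ht'.zero, Category.assoc, hc.zero]
    simp
  · rw [hP.lift_snd]

theorem exists_pushExt {Z A A' : C} (a : A ⟶ A') (x : 𝓔.Ext Z A) :
    ∃ y : 𝓔.Ext Z A', Mor a (𝟙 Z) x y ∧ ∀ {T B : C} (d : A' ⟶ B) (c : Z ⟶ T) (t : 𝓔.Ext T B),
      Mor (a ≫ d) c x t → Mor d c y t := by
  obtain ⟨X, i, p, h, rfl⟩ := x.exists_rep
  obtain ⟨P, b, j, q, hP, hq, hc⟩ := h.exists_pushout a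
  refine ⟨hc.ext, (mor_iff rfl rfl).2 ⟨b, hP.w, by simp [hq]⟩, fun {T B} d c t ht => ?_⟩
  obtain ⟨Y, k, r, ht', rfl⟩ := t.exists_rep
  obtain ⟨m, h₁, h₂⟩ := (mor_iff rfl rfl).1 ht
  refine (mor_iff rfl rfl).2 ⟨hP.desc m (d ≫ k) (by rw [h₁, Category.assoc]), ?_, hP.hom_ext ?_ ?_⟩
  · rw [hP.inr_desc]
  · rw [hP.inl_desc_assoc, h₂, reassoc_of% hq]
  · rw [hP.inr_desc_assoc, Category.assoc, ht'.zero, reassoc_of% hc.zero]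
    simp

/-- The class `x · c` of the pullback of a conflation in the class `x` along `c`. -/
noncomputable def pullExt {Z Z' A : C} (c : Z' ⟶ Z) (x : 𝓔.Ext Z A) : 𝓔.Ext Z' A :=
  (exists_pullExt c x).choose

/-- The class `a · x` of the pushout of a conflation in the class `x` along `a`. -/
noncomputable def pushExt {Z A A' : C} (a : A ⟶ A') (x : 𝓔.Ext Z A) : 𝓔.Ext Z A' :=
  (exists_pushExt a x).choose

theorem mor_pullExt {Z Z' A : C} (c : Z' ⟶ Z) (x : 𝓔.Ext Z A) : Mor (𝟙 A) c (pullExt c x) x :=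
  (exists_pullExt c x).choose_spec.1

theorem mor_pushExt {Z A A' : C} (a : A ⟶ A') (x : 𝓔.Ext Z A) : Mor a (𝟙 Z) x (pushExt a x) :=
  (exists_pushExt a x).choose_spec.1

theorem Mor.to_pullExt {Z Z' A T B : C} {c : Z' ⟶ Z} {x : 𝓔.Ext Z A} {a : B ⟶ A} {d : T ⟶ Z'}
    {t : 𝓔.Ext T B} (h : Mor a (d ≫ c) t x) : Mor a d t (pullExt c x) :=
  (exists_pullExt c x).choose_spec.2 a d t h

theorem Mor.of_pushExt {Z A A' T B : C} {a : A ⟶ A'} {x : 𝓔.Ext Z A} {d : A' ⟶ B} {c : Z ⟶ T}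
    {t : 𝓔.Ext T B} (h : Mor (a ≫ d) c x t) : Mor d c (pushExt a x) t :=
  (exists_pushExt a x).choose_spec.2 d c t h

theorem Mor.eq_pullExt {Z Z' A : C} {c : Z' ⟶ Z} {x : 𝓔.Ext Z A} {y : 𝓔.Ext Z' A}
    (h : Mor (𝟙 A) c y x) : y = pullExt c x :=
  Mor.eq (Mor.to_pullExt (by rwa [Category.id_comp]))

theorem Mor.pushExt_eq {Z A A' : C} {a : A ⟶ A'} {x : 𝓔.Ext Z A} {y : 𝓔.Ext Z A'}
    (h : Mor a (𝟙 Z) x y) : pushExt a x = y :=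
  Mor.eq (Mor.of_pushExt (by rwa [Category.comp_id]))

theorem mor_iff_pushExt_eq_pullExt {Z Z' A A' : C} {a : A ⟶ A'} {c : Z ⟶ Z'} {x : 𝓔.Ext Z A}
    {y : 𝓔.Ext Z' A'} : Mor a c x y ↔ pushExt a x = pullExt c y := by
  constructor
  · intro h
    exact Mor.eq_pullExt (Mor.of_pushExt (by rwa [Category.comp_id]))
  · intro h
    have h₁ := mor_pushExt a x
    rw [h] at h₁
    simpa using h₁.comp (mor_pullExt c y)

theorem pullExt_id {Z A : C} (x : 𝓔.Ext Z A) : pullExt (𝟙 Z) x = x :=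
  (Mor.refl x).eq_pullExt.symm

theorem pushExt_id {Z A : C} (x : 𝓔.Ext Z A) : pushExt (𝟙 A) x = x :=
  (Mor.refl x).pushExt_eq

theorem pullExt_pullExt {Z Z' Z'' A : C} (c : Z' ⟶ Z) (c' : Z'' ⟶ Z') (x : 𝓔.Ext Z A) :
    pullExt c' (pullExt c x) = pullExt (c' ≫ c) x := by
  refine Mor.eq_pullExt ?_
  simpa using (mor_pullExt c' (pullExt c x)).comp (mor_pullExt c x)

theorem pushExt_pushExt {Z A A' A'' : C} (a : A ⟶ A') (a' : A' ⟶ A'') (x : 𝓔.Ext Z A) :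
    pushExt a' (pushExt a x) = pushExt (a ≫ a') x := by
  refine (Mor.pushExt_eq ?_).symm
  simpa using (mor_pushExt a x).comp (mor_pushExt a' (pushExt a x))

theorem pushExt_pullExt {Z Z' A A' : C} (a : A ⟶ A') (c : Z' ⟶ Z) (x : 𝓔.Ext Z A) :
    pushExt a (pullExt c x) = pullExt c (pushExt a x) := by
  rw [← mor_iff_pushExt_eq_pullExt]
  simpa using (mor_pullExt c x).comp (mor_pushExt a x)

theorem Mor.unique {Z A A' : C} {a : A ⟶ A'} {x : 𝓔.Ext Z A} {y z : 𝓔.Ext Z A'}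
    (h : Mor a (𝟙 Z) x y) (h' : Mor a (𝟙 Z) x z) : y = z :=
  h.pushExt_eq.symm.trans h'.pushExt_eq

section Sum

variable [HasBinaryBiproducts C]

theorem exists_pair {Z A B : C} (x : 𝓔.Ext Z A) (y : 𝓔.Ext Z B) : ∃ w : 𝓔.Ext Z (A ⊞ B),
    Mor biprod.fst (𝟙 Z) w x ∧ Mor biprod.snd (𝟙 Z) w y ∧
    (∀ {T D : C} (a : D ⟶ A) (b : D ⟶ B) (c : T ⟶ Z) (t : 𝓔.Ext T D),
      Mor a c t x → Mor b c t y → Mor (biprod.lift a b) c t w) ∧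
    (∀ {T D : C} (a : A ⟶ D) (b : B ⟶ D) (c d : Z ⟶ T) (t : 𝓔.Ext T D),
      Mor a c x t → Mor b d y t → Mor (biprod.desc a b) (c + d) w t) := by
  obtain ⟨X, i, p, h, rfl⟩ := x.exists_rep
  obtain ⟨X', i', p', h', rfl⟩ := y.exists_rep
  have hs := h.sum h' (BinaryBiproduct.isBilimit A B) (BinaryBiproduct.isBilimit X X')
    (BinaryBiproduct.isBilimit Z Z)
  have hm := mor_pullExt (biprod.lift (𝟙 Z) (𝟙 Z)) hs.ext
  have h₁ : Mor biprod.fst biprod.fst hs.ext h.ext :=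
    (mor_iff rfl rfl).2 ⟨biprod.fst, by simp, by simp⟩
  have h₂ : Mor biprod.snd biprod.snd hs.ext h'.ext :=
    (mor_iff rfl rfl).2 ⟨biprod.snd, by simp, by simp⟩
  refine ⟨pullExt (biprod.lift (𝟙 Z) (𝟙 Z)) hs.ext, by simpa using hm.comp h₁,
    by simpa using hm.comp h₂, fun {T D} a b c t ha hb => ?_, fun {T D} a b c d t hc hd => ?_⟩
  · obtain ⟨Y, k, r, ht, rfl⟩ := t.exists_rep
    obtain ⟨m, hm₁, hm₂⟩ := (mor_iff rfl rfl).1 ha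
    obtain ⟨n, hn₁, hn₂⟩ := (mor_iff rfl rfl).1 hb
    refine Mor.to_pullExt ((mor_iff rfl rfl).2 ⟨biprod.lift m n, ?_, ?_⟩)
    · ext <;> simp [hm₁, hn₁]
    · ext <;> simp [hm₂, hn₂]
  · obtain ⟨Y, k, r, ht, rfl⟩ := t.exists_rep
    obtain ⟨m, hm₁, hm₂⟩ := (mor_iff rfl rfl).1 hc
    obtain ⟨n, hn₁, hn₂⟩ := (mor_iff rfl rfl).1 hd
    have h₃ : Mor (biprod.desc a b) (biprod.desc c d) hs.ext ht.ext := by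
      refine (mor_iff rfl rfl).2 ⟨biprod.desc m n, ?_, ?_⟩
      · ext <;> simp [hm₁, hn₁]
      · ext <;> simp [hm₂, hn₂]
    simpa using hm.comp h₃

/-- The extension of `Z` by `A ⊞ B` with components `x` and `y`. -/
noncomputable def pairExt {Z A B : C} (x : 𝓔.Ext Z A) (y : 𝓔.Ext Z B) : 𝓔.Ext Z (A ⊞ B) :=
  (exists_pair x y).choose

theorem mor_pairExt_fst {Z A B : C} (x : 𝓔.Ext Z A) (y : 𝓔.Ext Z B) :
    Mor biprod.fst (𝟙 Z) (pairExt x y) x := (exists_pair x y).choose_spec.1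

theorem mor_pairExt_snd {Z A B : C} (x : 𝓔.Ext Z A) (y : 𝓔.Ext Z B) :
    Mor biprod.snd (𝟙 Z) (pairExt x y) y := (exists_pair x y).choose_spec.2.1

/-- The Baer sum. -/
noncomputable instance instAddExt (Z A : C) : Add (𝓔.Ext Z A) where
  add x y := pushExt (biprod.desc (𝟙 A) (𝟙 A)) (pairExt x y)

/-- The class of the split conflation. -/
noncomputable instance instZeroExt (Z A : C) : Zero (𝓔.Ext Z A) where
  zero := (conf_split (𝓔 := 𝓔) _ (BinaryBiproduct.isBilimit A Z)).ext

noncomputable instance instNegExt (Z A : C) : Neg (𝓔.Ext Z A) where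
  neg x := pushExt (-𝟙 A) x

theorem Mor.add {Z A T D : C} {x y : 𝓔.Ext Z A} {a b : D ⟶ A} {c : T ⟶ Z} {t : 𝓔.Ext T D}
    (h : Mor a c t x) (h' : Mor b c t y) : Mor (a + b) c t (x + y) := by
  change Mor (a + b) c t (pushExt (biprod.desc (𝟙 A) (𝟙 A)) (pairExt x y))
  simpa using ((exists_pair x y).choose_spec.2.2.1 a b c t h h').comp
    (mor_pushExt (biprod.desc (𝟙 A) (𝟙 A)) (pairExt x y))

theorem Mor.add' {Z A T D : C} {x y : 𝓔.Ext Z A} {a : A ⟶ D} {c d : Z ⟶ T} {t : 𝓔.Ext T D}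
    (h : Mor a c x t) (h' : Mor a d y t) : Mor a (c + d) (x + y) t := by
  refine Mor.of_pushExt ?_
  have := (exists_pair x y).choose_spec.2.2.2 a a c d t h h'
  have e : biprod.desc a a = biprod.desc (𝟙 A) (𝟙 A) ≫ a := by ext <;> simp
  rwa [e] at this

theorem mor_zero {Z A Z' A' : C} (c : Z ⟶ Z') (x : 𝓔.Ext Z A) :
    Mor (0 : A ⟶ A') c x (0 : 𝓔.Ext Z' A') := by
  obtain ⟨X, i, p, h, rfl⟩ := x.exists_rep
  exact (mor_iff rfl rfl).2 ⟨p ≫ c ≫ biprod.inr, by simp [reassoc_of% h.zero], by simp⟩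

noncomputable instance instAddCommGroupExt (Z A : C) : AddCommGroup (𝓔.Ext Z A) where
  add_assoc x y z := by
    have h₁ := (mor_pairExt_fst (pairExt x y) z).comp (mor_pairExt_fst x y)
    have h₂ := (mor_pairExt_fst (pairExt x y) z).comp (mor_pairExt_snd x y)
    have h₃ := mor_pairExt_snd (pairExt x y) z
    rw [Category.comp_id] at h₁ h₂
    have h := h₁.add (h₂.add h₃)
    rw [← add_assoc] at h
    exact ((h₁.add h₂).add h₃).unique h
  zero_add x := by
    have h := (mor_zero (𝟙 Z) x).add (Mor.refl x)
    rw [zero_add] at h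
    exact h.eq.symm
  add_zero x := by
    have h := (Mor.refl x).add (mor_zero (𝟙 Z) x)
    rw [add_zero] at h
    exact h.eq.symm
  add_comm x y := by
    have h := (mor_pairExt_snd x y).add (mor_pairExt_fst x y)
    rw [add_comm] at h
    exact ((mor_pairExt_fst x y).add (mor_pairExt_snd x y)).unique h
  neg_add_cancel x := by
    have h := (mor_pushExt (-𝟙 A) x).add (Mor.refl x)
    rw [neg_add_cancel] at h
    exact h.unique (mor_zero (𝟙 Z) x)
  nsmul := nsmulRec
  zsmul := zsmulRec

theorem pushExt_add_left {Z A A' : C} (a a' : A ⟶ A') (x : 𝓔.Ext Z A) :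
    pushExt (a + a') x = pushExt a x + pushExt a' x :=
  ((mor_pushExt a x).add (mor_pushExt a' x)).pushExt_eq

theorem pullExt_add_left {Z Z' A : C} (c c' : Z' ⟶ Z) (x : 𝓔.Ext Z A) :
    pullExt (c + c') x = pullExt c x + pullExt c' x :=
  ((mor_pullExt c x).add' (mor_pullExt c' x)).eq_pullExt.symm

theorem pushExt_add {Z A A' : C} (a : A ⟶ A') (x y : 𝓔.Ext Z A) :
    pushExt a (x + y) = pushExt a x + pushExt a y := by
  have h₁ := (mor_pairExt_fst x y).comp (mor_pushExt a x)
  have h₂ := (mor_pairExt_snd x y).comp (mor_pushExt a y)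
  have h₃ := (((mor_pairExt_fst x y).add (mor_pairExt_snd x y)).comp (mor_pushExt a (x + y)))
  rw [Preadditive.add_comp] at h₃
  rw [Category.comp_id] at h₁ h₂ h₃
  exact h₃.unique (h₁.add h₂)

theorem pullExt_add {Z Z' A : C} (c : Z' ⟶ Z) (x y : 𝓔.Ext Z A) :
    pullExt c (x + y) = pullExt c x + pullExt c y := by
  have h := mor_pullExt c (pairExt x y)
  have h₁ := h.comp (mor_pairExt_fst x y)
  have h₂ := h.comp (mor_pairExt_snd x y)
  have h₃ := h₁.add h₂
  have h₄ := h.comp ((mor_pairExt_fst x y).add (mor_pairExt_snd x y))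
  rw [← Preadditive.comp_add] at h₃
  rw [Category.comp_id, Category.id_comp] at h₁ h₂ h₄
  have h₁' : Mor biprod.fst (𝟙 Z') (pullExt c (pairExt x y)) (pullExt c x) :=
    Mor.to_pullExt (by rwa [Category.id_comp])
  have h₂' : Mor biprod.snd (𝟙 Z') (pullExt c (pairExt x y)) (pullExt c y) :=
    Mor.to_pullExt (by rwa [Category.id_comp])
  have h₄' : Mor (biprod.fst + biprod.snd) (𝟙 Z') (pullExt c (pairExt x y))
      (pullExt c (x + y)) := Mor.to_pullExt (by rwa [Category.id_comp])
  exact h₄'.unique (h₁'.add h₂')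

end Sum

end ExtGroups

section Canonical

variable {C : Type u} [Category.{v} C] [Preadditive C] (𝓔 : ExactStructure C)

/-- The bifunctor `Ext : Cᵒᵖ × C ⥤ Ab`. -/
noncomputable def extFunctor [HasBinaryBiproducts C] :
    Cᵒᵖ × C ⥤ AddCommGrpCat.{max u v} where
  obj P := AddCommGrpCat.of (𝓔.Ext P.1.unop P.2)
  map f := AddCommGrpCat.ofHom
    (AddMonoidHom.mk' (fun x => pushExt f.2 (pullExt f.1.unop x))
      (fun x y => by rw [pullExt_add, pushExt_add]))
  map_id P := by
    ext x
    exact (pushExt_id _).trans (pullExt_id _)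
  map_comp f g := by
    ext x
    change pushExt (f.2 ≫ g.2) (pullExt (g.1.unop ≫ f.1.unop) x) =
      pushExt g.2 (pullExt g.1.unop (pushExt f.2 (pullExt f.1.unop x)))
    rw [← pushExt_pullExt, pushExt_pushExt, pullExt_pullExt]

variable {𝓔}

theorem pull_extFunctor [HasBinaryBiproducts C] {Z Z' A : C} (c : Z' ⟶ Z) (x : 𝓔.Ext Z A) :
    pull 𝓔.extFunctor c A x = pullExt c x := pushExt_id _

theorem push_extFunctor [HasBinaryBiproducts C] {Z A A' : C} (a : A ⟶ A') (x : 𝓔.Ext Z A) :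
    push 𝓔.extFunctor Z a x = pushExt a x := congrArg (pushExt a) (pullExt_id _)

theorem act_extFunctor [HasBinaryBiproducts C] {Z Z' A A' : C} (c : Z' ⟶ Z) (a : A ⟶ A')
    (x : 𝓔.Ext Z A) : act 𝓔.extFunctor c a x = pushExt a (pullExt c x) := rfl

theorem push_eq_pull_iff [HasBinaryBiproducts C] {Z Z' A A' : C} {a : A ⟶ A'} {c : Z ⟶ Z'}
    {x : 𝓔.Ext Z A} {y : 𝓔.Ext Z' A'} :
    push 𝓔.extFunctor Z a x = pull 𝓔.extFunctor c A' y ↔ Mor a c x y := by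
  rw [mor_iff_pushExt_eq_pullExt, ← push_extFunctor, ← pull_extFunctor]
  exact Iff.rfl

variable (𝓔)

/-- The canonical extriangulated structure of an exact category: the extensions are the
equivalence classes of conflations, and every extension is its own realization. -/
noncomputable def extriangulated [HasFiniteBiproducts C] : Extriangulated.{max u v} C :=
  haveI := hasBinaryBiproducts_of_finite_biproducts C
  { hasFiniteBiproducts := inferInstance
    E := 𝓔.extFunctor
    pull_add := fun c c' x => by
      refine (pull_extFunctor _ _).trans ((pullExt_add_left c c' x).trans ?_)
      exact congrArg₂ (· + ·) (pull_extFunctor c x).symm (pull_extFunctor c' x).symm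
    push_add := fun a a' x => by
      refine (push_extFunctor _ _).trans ((pushExt_add_left a a' x).trans ?_)
      exact congrArg₂ (· + ·) (push_extFunctor a x).symm (push_extFunctor a' x).symm
    s := fun x => x.1
    exists_realization := fun hx hx' a c h => (mor_iff hx hx').1 (push_eq_pull_iff.1 h)
    s_zero := fun b hb => by
      have h : Mor (𝟙 _) (𝟙 _) (0 : 𝓔.Ext _ _) (conf_split b hb).ext :=
        (mor_iff rfl rfl).2 ⟨biprod.desc b.inl b.inr, by simp, by ext <;> simp⟩
      exact congrArg Subtype.val h.eq
    s_sum := fun {Z Z' A A' X X' x x' i p i' p'} hx hx' bA bX bZ hA hX hZ => by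
      obtain ⟨h, rfl⟩ := Ext.exists_conf hx
      obtain ⟨h', rfl⟩ := Ext.exists_conf hx'
      have hs := h.sum h' hA hX hZ
      have h₁ : Mor bA.fst bZ.fst hs.ext h.ext :=
        (mor_iff rfl rfl).2 ⟨bX.fst, by simp, by simp⟩
      have h₂ : Mor bA.snd bZ.snd hs.ext h'.ext :=
        (mor_iff rfl rfl).2 ⟨bX.snd, by simp, by simp⟩
      have h₁' : Mor bA.fst (𝟙 _) hs.ext (pullExt bZ.fst h.ext) :=
        Mor.to_pullExt (by rwa [Category.id_comp])
      have h₂' : Mor bA.snd (𝟙 _) hs.ext (pullExt bZ.snd h'.ext) :=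
        Mor.to_pullExt (by rwa [Category.id_comp])
      have h₁'' := h₁'.comp (mor_pushExt bA.inl _)
      have h₂'' := h₂'.comp (mor_pushExt bA.inr _)
      have h₃ := h₁''.add h₂''
      rw [IsBilimit.binary_total hA, Category.id_comp] at h₃
      exact congrArg Subtype.val h₃.eq.symm
    et3 := fun {Z Z' A A' X X' x x' i p i' p'} hx hx' a b hab => by
      obtain ⟨h, rfl⟩ := Ext.exists_conf hx
      obtain ⟨h', rfl⟩ := Ext.exists_conf hx'
      obtain ⟨c, hc⟩ := h.desc (b ≫ p') (by rw [reassoc_of% hab, h'.zero, comp_zero])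
      exact ⟨c, hc.symm, push_eq_pull_iff.2 ((mor_iff hx hx').2 ⟨b, hab, hc.symm⟩)⟩
    et3_op := fun {Z Z' A A' X X' x x' i p i' p'} hx hx' b c hbc => by
      obtain ⟨h, rfl⟩ := Ext.exists_conf hx
      obtain ⟨h', rfl⟩ := Ext.exists_conf hx'
      obtain ⟨a, ha⟩ := h'.lift (i ≫ b) (by
        rw [Category.assoc, hbc, reassoc_of% h.zero, zero_comp])
      exact ⟨a, ha.symm, push_eq_pull_iff.2 ((mor_iff hx hx').2 ⟨b, ha.symm, hbc⟩)⟩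
    et4 := fun {A B M D F x y f f' g g'} hx hy => by
      obtain ⟨h, rfl⟩ := Ext.exists_conf hx
      obtain ⟨h', rfl⟩ := Ext.exists_conf hy
      obtain ⟨N, k, d, e, hN, he, hc⟩ := h'.exists_pushout f'
      have := h'.epi
      have := h.epi
      have hk : 𝓔.Conf (f ≫ g) k := by
        have hk' : Epi k := by
          refine Preadditive.epi_of_cancel_zero k fun {T} t ht => hN.hom_ext (by simpa using ht) ?_
          rw [← cancel_epi f', ← reassoc_of% hN.w, ht]
          simp
        refine conf_of_inflation (𝓔.comp_inflation f g h.inflation h'.inflation) ?_ ?_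
        · rw [Category.assoc, hN.w, reassoc_of% h.zero, zero_comp]
        · intro T t ht
          obtain ⟨l, hl⟩ := h.desc (g ≫ t) (by simpa using ht)
          exact ⟨hN.desc t l hl.symm, hN.inl_desc _ _ _⟩
      have m₁ : Mor f' (𝟙 F) h'.ext hc.ext := (mor_iff rfl rfl).2 ⟨k, hN.w, by simp [he]⟩
      have m₂ : Mor (𝟙 A) d h.ext hk.ext := (mor_iff rfl rfl).2 ⟨g, by simp, hN.w⟩
      have m₃ : Mor f e hk.ext h'.ext := (mor_iff rfl rfl).2 ⟨𝟙 M, by simp, by simp [he]⟩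
      refine ⟨N, k, d, e, hk.ext, rfl, hN.w.symm, he, ?_, ?_, push_eq_pull_iff.2 m₃⟩
      · rw [push_extFunctor, m₁.pushExt_eq]
        rfl
      · rw [pull_extFunctor]
        exact m₂.eq_pullExt.symm
    et4_op := fun {A B M D F x y f' f g' g} hx hy => by
      obtain ⟨h, rfl⟩ := Ext.exists_conf hx
      obtain ⟨h', rfl⟩ := Ext.exists_conf hy
      obtain ⟨N, k, d, e, hN, he, hc⟩ := h.exists_pullback g'
      have := h'.mono
      have hk : 𝓔.Conf k (f ≫ g) := by
        have hk' : Mono k := by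
          refine Preadditive.mono_of_cancel_zero k fun {T} t ht => hN.hom_ext (by simpa using ht) ?_
          rw [← cancel_mono g', Category.assoc, ← hN.w, reassoc_of% ht]
          simp
        refine conf_of_deflation (𝓔.comp_deflation f g h.deflation h'.deflation) ?_ ?_
        · rw [reassoc_of% hN.w, h'.zero, comp_zero]
        · intro T t ht
          obtain ⟨l, hl⟩ := h'.lift (t ≫ f) (by simpa using ht)
          exact ⟨hN.lift t l hl.symm, hN.lift_fst _ _ _⟩
      have m₁ : Mor (𝟙 D) g' hc.ext h.ext := (mor_iff rfl rfl).2 ⟨k, by simp [he], hN.w⟩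
      have m₂ : Mor e (𝟙 M) hk.ext h'.ext := (mor_iff rfl rfl).2 ⟨f, hN.w, by simp⟩
      have m₃ : Mor d g h.ext hk.ext := (mor_iff rfl rfl).2 ⟨𝟙 A, by simp [he], by simp⟩
      refine ⟨N, k, d, e, hk.ext, rfl, he, hN.w, ?_, ?_, push_eq_pull_iff.2 m₃⟩
      · rw [pull_extFunctor, ← m₁.eq_pullExt]
        rfl
      · rw [push_extFunctor]
        exact m₂.pushExt_eq }

end Canonical
end ExactStructure

section Higher

variable {C : Type u} [Category.{v} C] (G E : Cᵒᵖ × C ⥤ AddCommGrpCat.{max u w})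

/-- Formal products `x · y` with `x ∈ G(M, A)` and `y ∈ E(Z, M)` for some object `M`. -/
abbrev FormalProduct (Z A : C) : Type (max u w) :=
  Σ M : C, G.obj (op M, A) × E.obj (op Z, M)

/-- The relations `(x + x') · y = x · y + x' · y`, `x · (y + y') = x · y + x · y'` and
`(x · m) · y = x · (m · y)`. -/
inductive ProductRel (Z A : C) : FreeAbelianGroup (FormalProduct.{w} G E Z A) → Prop
  | add_left (M : C) (x x' : G.obj (op M, A)) (y : E.obj (op Z, M)) :
      ProductRel Z A (FreeAbelianGroup.of ⟨M, x + x', y⟩ -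
        (FreeAbelianGroup.of ⟨M, x, y⟩ + FreeAbelianGroup.of ⟨M, x', y⟩))
  | add_right (M : C) (x : G.obj (op M, A)) (y y' : E.obj (op Z, M)) :
      ProductRel Z A (FreeAbelianGroup.of ⟨M, x, y + y'⟩ -
        (FreeAbelianGroup.of ⟨M, x, y⟩ + FreeAbelianGroup.of ⟨M, x, y'⟩))
  | balance {M M' : C} (m : M ⟶ M') (x : G.obj (op M', A)) (y : E.obj (op Z, M)) :
      ProductRel Z A (FreeAbelianGroup.of ⟨M, pull G m A x, y⟩ -
        FreeAbelianGroup.of ⟨M', x, push E Z m y⟩)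

/-- The group `∫^M G(M, A) ⊗ E(Z, M)`, generated by the products `x · y` with `x ∈ G(M, A)` and
`y ∈ E(Z, M)`, subject to biadditivity and to `(x · m) · y = x · (m · y)`. -/
abbrev ProductGroup (Z A : C) : Type (max u w) :=
  FreeAbelianGroup (FormalProduct.{w} G E Z A) ⧸ AddSubgroup.closure {t | ProductRel.{w} G E Z A t}

/-- The formal product `(a · x) · (y · c)`. -/
def FormalProduct.act {Z Z' A A' : C} (c : Z' ⟶ Z) (a : A ⟶ A')
    (t : FormalProduct.{w} G E Z A) : FormalProduct.{w} G E Z' A' :=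
  ⟨t.1, push G t.1 a t.2.1, pull E c t.1 t.2.2⟩

theorem map_productRel {Z Z' A A' : C} (c : Z' ⟶ Z) (a : A ⟶ A')
    {t : FreeAbelianGroup (FormalProduct.{w} G E Z A)} (ht : ProductRel.{w} G E Z A t) :
    ProductRel.{w} G E Z' A' (FreeAbelianGroup.map (FormalProduct.act.{w} G E c a) t) := by
  cases ht with
  | add_left M x x' y =>
    simp only [map_sub, map_add, FreeAbelianGroup.map_of_apply, FormalProduct.act]
    exact .add_left M _ _ _
  | add_right M x y y' =>
    simp only [map_sub, map_add, FreeAbelianGroup.map_of_apply, FormalProduct.act]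
    exact .add_right M _ _ _
  | @balance M M' m x y =>
    have h₁ : push G M a (pull G m A x) = pull G m A' (push G M' a x) := by
      refine (act_comp G _ _ _ _ _).trans (Eq.trans ?_ (act_comp G _ _ _ _ _).symm)
      simp
    have h₂ : pull E c M' (push E Z m y) = push E Z' m (pull E c M y) := by
      refine (act_comp E _ _ _ _ _).trans (Eq.trans ?_ (act_comp E _ _ _ _ _).symm)
      simp
    simp only [map_sub, FreeAbelianGroup.map_of_apply, FormalProduct.act, h₁, h₂]
    exact .balance m _ _

/-- The map `x · y ↦ (a · x) · (y · c)`. -/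
def ProductGroup.map {Z Z' A A' : C} (c : Z' ⟶ Z) (a : A ⟶ A') :
    ProductGroup.{w} G E Z A →+ ProductGroup.{w} G E Z' A' :=
  QuotientAddGroup.map _ _ (FreeAbelianGroup.map (FormalProduct.act.{w} G E c a))
    ((AddSubgroup.closure_le _).2 fun _ ht =>
      AddSubgroup.subset_closure (map_productRel G E c a ht))

/-- The bifunctor `(Z, A) ↦ ∫^M G(M, A) ⊗ E(Z, M)`. -/
def productFunctor : Cᵒᵖ × C ⥤ AddCommGrpCat.{max u w} where
  obj P := AddCommGrpCat.of (ProductGroup.{w} G E P.1.unop P.2)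
  map f := AddCommGrpCat.ofHom (ProductGroup.map.{w} G E f.1.unop f.2)
  map_id P := by
    ext x
    refine congrArg (fun t => QuotientAddGroup.mk (FreeAbelianGroup.of t)) ?_
    exact congrArg (Sigma.mk x.1) (Prod.ext (act_id G _) (act_id E _))
  map_comp {P Q R} f g := by
    ext x
    refine congrArg (fun t => QuotientAddGroup.mk (FreeAbelianGroup.of t)) ?_
    refine congrArg (Sigma.mk x.1) (Prod.ext ?_ ?_)
    · refine Eq.trans ?_ (act_comp G _ _ _ _ _).symm
      exact congrArg (fun m => act G m (f.2 ≫ g.2) x.2.1) (Category.comp_id (𝟙 x.1)).symm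
    · refine Eq.trans ?_ (act_comp E _ _ _ _ _).symm
      exact congrArg (fun m => act E (g.1.unop ≫ f.1.unop) m x.2.2)
        (Category.comp_id (𝟙 x.1)).symm

/-- The higher extension bifunctors: `extSucc E n` is `E^{n+1}`. They are defined by `E^1 = E` and
`E^{n+2}(Z, A) = ∫^M E^{n+1}(M, A) ⊗ E(Z, M)`. For the bifunctor `Ext` of an exact category these
are the groups of Yoneda extensions `Ext^{n+1}`, the product `x · y` being the splice of an
`(n+1)`-extension with a conflation. -/
def extSucc (E : Cᵒᵖ × C ⥤ AddCommGrpCat.{max u w}) :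
    ℕ → (Cᵒᵖ × C ⥤ AddCommGrpCat.{max u w})
  | 0 => E
  | n + 1 => productFunctor.{w} (extSucc E n) E

end Higher

end Extri

/-! The map τ is injective in every exact category: an extension of `∐ Z_i` splits if and only if
its deflation has a section, and sections over the `Z_i` glue by the universal property
(`ext_coprod_eq_zero`). So (e) only asks that every family `y_i ∈ Ext(Z_i, A)` glue to an extension
of `∐ Z_i`.

Gluing follows as soon as some extension of `∐ Z_i` by `A^(I)` receives morphisms from all `y_i`
that are the inclusions on the ends: push it out along the codiagonal `A^(I) ⟶ A` (`exists_glue`).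
Both (b) and (d) supply such an extension. Conversely, given gluing, the extension that glues the
pushouts `μ_i · y_i` has the coproduct of the middle terms as its own middle term
(`Conf.isCoprod_mid`). Hence coproducts of conflations are conflations (`conf_coprod`), and
injectivity of τ makes the assignment additive and natural, which is (c) (`colimExtriangulated`).
The identity required for (a) says that the inclusions are morphisms of extensions.

For higher Ext, every element of `Ext^{n+1}(Z, A)` is a single product `x · y` (`exists_splice`), so
surjectivity of τ follows by gluing the `x_i` and the `μ_i · y_i` separately. For injectivity one
must know when `x · y` vanishes: if `y` is the class of `M ⟶ X ⟶ Z`, exactly when `x` extends to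
`X`. One direction is `Conf.splice_pull_eq_zero`; the other, `Conf.exists_of_splice_eq_zero`, is
exactness at one place of the long exact sequence, obtained directly from the presentation by
generators and relations. It needs half exactness of `Ext^n(-, A)`, which is carried along the
induction. If all `x · (y · μ_i)` vanish, the extensions of `x` to the middle terms `X_i` glue over
`∐ X_i`, and `x · y = 0` results (`splice_eq_zero_of_colimit`). -/

namespace Extri

/-! ### Coproducts through their universal property, independent of chosen colimits -/

section Coprod

variable {C : Type u} [Category.{v} C]

/-- The morphisms `μ i : Z i ⟶ S` exhibit `S` as a coproduct of the family `Z`. -/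
def IsCoprod {I : Type*} {Z : I → C} {S : C} (μ : ∀ i, Z i ⟶ S) : Prop :=
  ∀ (T : C) (t : ∀ i, Z i ⟶ T), ∃! s : S ⟶ T, ∀ i, μ i ≫ s = t i

theorem IsCoprod.exists_desc {I : Type*} {Z : I → C} {S : C} {μ : ∀ i, Z i ⟶ S}
    (h : IsCoprod μ) {T : C} (t : ∀ i, Z i ⟶ T) : ∃ s : S ⟶ T, ∀ i, μ i ≫ s = t i :=
  (h T t).exists

theorem IsCoprod.hom_ext {I : Type*} {Z : I → C} {S : C} {μ : ∀ i, Z i ⟶ S}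
    (h : IsCoprod μ) {T : C} {s s' : S ⟶ T} (hs : ∀ i, μ i ≫ s = μ i ≫ s') : s = s' :=
  (h T fun i => μ i ≫ s').unique hs fun _ => rfl

theorem IsCoprod.exists_iso {I : Type*} {Z : I → C} {S S' : C} {μ : ∀ i, Z i ⟶ S}
    {μ' : ∀ i, Z i ⟶ S'} (h : IsCoprod μ) (h' : IsCoprod μ') :
    ∃ e : S ≅ S', ∀ i, μ i ≫ e.hom = μ' i := by
  obtain ⟨s, hs⟩ := h.exists_desc μ'
  obtain ⟨t, ht⟩ := h'.exists_desc μ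
  exact ⟨⟨s, t, h.hom_ext fun i => by rw [reassoc_of% hs, ht, Category.comp_id],
    h'.hom_ext fun i => by rw [reassoc_of% ht, hs, Category.comp_id]⟩, hs⟩

theorem isCoprod_colimit {I : Type*} (F : Discrete I ⥤ C) [HasColimit F] :
    IsCoprod fun i : I => colimit.ι F ⟨i⟩ := by
  intro T t
  refine ⟨colimit.desc F ⟨T, Discrete.natTrans fun i => t i.as⟩, fun i => colimit.ι_desc _ _,
    fun s hs => colimit.hom_ext fun i => ?_⟩
  rw [colimit.ι_desc]
  exact hs i.as

end Coprod

namespace ExactStructure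

variable {C : Type u} [Category.{v} C] [Preadditive C] {𝓔 : ExactStructure C}

/-! ### Splitting as an obstruction, and injectivity of τ -/

section Vanishing

variable [HasBinaryBiproducts C] {A X Z : C} {i : A ⟶ X} {p : X ⟶ Z}

/-- A morphism from the split conflation on `A ⊞ Z'` which is the identity on `A` is given by `i` on
the first summand and a lift of `c` on the second. -/
theorem Conf.pullExt_eq_zero_iff (h : 𝓔.Conf i p) {Z' : C} (c : Z' ⟶ Z) :
    pullExt c h.ext = 0 ↔ ∃ l : Z' ⟶ X, l ≫ p = c := by
  constructor
  · intro h0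
    have hm := mor_pullExt c h.ext
    rw [h0] at hm
    obtain ⟨b, h₁, h₂⟩ := (mor_iff (i := biprod.inl) (p := biprod.snd) rfl rfl).1 hm
    exact ⟨biprod.inr ≫ b, by simp [h₂]⟩
  · rintro ⟨l, hl⟩
    have hm : Mor (𝟙 A) c (0 : 𝓔.Ext Z' A) h.ext :=
      (mor_iff (i := biprod.inl) (p := biprod.snd) rfl rfl).2
        ⟨biprod.desc i l, by simp, by ext <;> simp [h.zero, hl]⟩
    exact hm.eq_pullExt.symm

/-- Dually, a morphism to the split conflation which is the identity on `Z` has an extension of `a`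
as its first component and `p` as its second. -/
theorem Conf.pushExt_eq_zero_iff (h : 𝓔.Conf i p) {A' : C} (a : A ⟶ A') :
    pushExt a h.ext = 0 ↔ ∃ l : X ⟶ A', i ≫ l = a := by
  constructor
  · intro h0
    have hm := mor_pushExt a h.ext
    rw [h0] at hm
    obtain ⟨b, h₁, h₂⟩ := (mor_iff (i' := biprod.inl) (p' := biprod.snd) rfl rfl).1 hm
    exact ⟨b ≫ biprod.fst, by simp [reassoc_of% h₁]⟩
  · rintro ⟨l, hl⟩
    have hm : Mor a (𝟙 Z) h.ext (0 : 𝓔.Ext Z A') :=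
      (mor_iff (i' := biprod.inl) (p' := biprod.snd) rfl rfl).2
        ⟨biprod.lift l p, by ext <;> simp [h.zero, hl], by simp⟩
    exact hm.pushExt_eq

theorem pullExt_sub {Z' : C} (c : Z' ⟶ Z) (x y : 𝓔.Ext Z A) :
    pullExt c (x - y) = pullExt c x - pullExt c y :=
  map_sub (AddMonoidHom.mk' (pullExt (𝓔 := 𝓔) (A := A) c) (pullExt_add c)) x y

/-- An extension of a coproduct vanishes if all its restrictions do. -/
theorem ext_coprod_eq_zero {I : Type*} {Zs : I → C} {ζ : ∀ j, Zs j ⟶ Z} (hζ : IsCoprod ζ)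
    (x : 𝓔.Ext Z A) (hx : ∀ j, pullExt (ζ j) x = 0) : x = 0 := by
  obtain ⟨X, i, p, h, rfl⟩ := x.exists_rep
  -- The lifts of the inclusions glue to a section of `p`, which splits `x`.
  choose l hl using fun j => (h.pullExt_eq_zero_iff (ζ j)).1 (hx j)
  obtain ⟨s, hs⟩ := hζ.exists_desc l
  have hsp : s ≫ p = 𝟙 Z := hζ.hom_ext fun j => by rw [reassoc_of% hs, hl, Category.comp_id]
  rw [← pullExt_id h.ext]
  exact (h.pullExt_eq_zero_iff (𝟙 Z)).2 ⟨s, hsp⟩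

theorem ext_coprod_ext {I : Type*} {Zs : I → C} {ζ : ∀ j, Zs j ⟶ Z} (hζ : IsCoprod ζ)
    {x y : 𝓔.Ext Z A} (hxy : ∀ j, pullExt (ζ j) x = pullExt (ζ j) y) : x = y :=
  sub_eq_zero.1 (ext_coprod_eq_zero hζ _ fun j => by rw [pullExt_sub, hxy, sub_self])

end Vanishing

/-! ### Gluing extensions and coproducts of conflations -/

section Coproducts

variable {I : Type*} {As Xs Zs : I → C} {fs : ∀ j, As j ⟶ Xs j}
  {gs : ∀ j, Xs j ⟶ Zs j} {A X Z : C} {f : A ⟶ X} {g : X ⟶ Z} {α : ∀ j, As j ⟶ A}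
  {ξ : ∀ j, Xs j ⟶ X} {ζ : ∀ j, Zs j ⟶ Z}

/-- If the coproduct of conflations with the same first term is a conflation, then the
corresponding extensions glue. -/
theorem exists_glue {B : C} {α : I → (B ⟶ A)} (hα : IsCoprod α) {y : ∀ j, 𝓔.Ext (Zs j) B}
    {x : 𝓔.Ext Z A} (h : ∀ j, Mor (α j) (ζ j) (y j) x) :
    ∃ x' : 𝓔.Ext Z B, ∀ j, pullExt (ζ j) x' = y j := by
  -- `d` is the codiagonal, so the restriction of `d · x` along `ζ j` is `d · α j · y j = y j`.
  obtain ⟨d, hd⟩ := hα.exists_desc fun _ => 𝟙 B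
  refine ⟨pushExt d x, fun j => ?_⟩
  rw [← pushExt_pullExt, ← mor_iff_pushExt_eq_pullExt.1 (h j), pushExt_pushExt, hd, pushExt_id]

variable [HasBinaryBiproducts C]

/-- If a conflation of coproducts restricts to given conflations, then its middle term is the
coproduct of their middle terms. -/
theorem Conf.isCoprod_mid (hs : ∀ j, 𝓔.Conf (fs j) (gs j)) (h : 𝓔.Conf f g) (hα : IsCoprod α)
    (hζ : IsCoprod ζ) (hf : ∀ j, fs j ≫ ξ j = α j ≫ f) (hg : ∀ j, ξ j ≫ g = gs j ≫ ζ j) :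
    IsCoprod ξ := by
  intro T t
  obtain ⟨a, ha⟩ := hα.exists_desc fun j => fs j ≫ t j
  -- The obstruction to extending `a` along `f` is the extension `a · h.ext`. Its restriction to `Zs
  -- j` is the pushout along `fs j ≫ t j`, which splits because `t j` extends that map.
  obtain ⟨s, hs'⟩ : ∃ s : X ⟶ T, f ≫ s = a := by
    rw [← h.pushExt_eq_zero_iff]
    refine ext_coprod_eq_zero hζ _ fun j => ?_
    have hm : Mor (α j) (ζ j) (hs j).ext h.ext := (mor_iff rfl rfl).2 ⟨ξ j, hf j, hg j⟩
    rw [← pushExt_pullExt, ← mor_iff_pushExt_eq_pullExt.1 hm, pushExt_pushExt, ha,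
      (hs j).pushExt_eq_zero_iff]
    exact ⟨t j, rfl⟩
  -- So far `s` agrees with `t j` only on `As j`. The errors factor through the `gs j`, hence glue
  -- to a map on `Z` by which `s` is corrected.
  choose r hr using fun j => (hs j).desc (ξ j ≫ s - t j) (by
    rw [Preadditive.comp_sub, reassoc_of% hf j, hs', ha, sub_self])
  obtain ⟨r', hr'⟩ := hζ.exists_desc r
  refine ⟨s - g ≫ r', fun j => ?_, fun s' hs'' => ?_⟩
  · rw [Preadditive.comp_sub, reassoc_of% hg j, hr', hr, sub_sub_cancel]
  · have h0 : ∀ d : X ⟶ T, (∀ j, ξ j ≫ d = 0) → d = 0 := by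
      intro d hd
      obtain ⟨k, rfl⟩ := h.desc d (hα.hom_ext fun j => by
        rw [← reassoc_of% hf j, hd, comp_zero, comp_zero])
      have hk : k = 0 := hζ.hom_ext fun j => by
        have := (hs j).epi
        rw [← cancel_epi (gs j), ← reassoc_of% hg j, hd, comp_zero, comp_zero]
      rw [hk, comp_zero]
    refine sub_eq_zero.1 (h0 _ fun j => ?_)
    rw [Preadditive.comp_sub, hs'', Preadditive.comp_sub, reassoc_of% hg j, hr', hr,
      sub_sub_cancel, sub_self]

/-- If families of extensions of the objects `Zs j` glue to extensions of their coproduct, then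
the coproduct of a family of conflations is a conflation. -/
theorem conf_coprod (hs : ∀ j, 𝓔.Conf (fs j) (gs j)) (hα : IsCoprod α) (hξ : IsCoprod ξ)
    (hζ : IsCoprod ζ) (hf : ∀ j, fs j ≫ ξ j = α j ≫ f) (hg : ∀ j, ξ j ≫ g = gs j ≫ ζ j)
    (H : ∀ y : ∀ j, 𝓔.Ext (Zs j) A, ∃ x : 𝓔.Ext Z A, ∀ j, pullExt (ζ j) x = y j) :
    𝓔.Conf f g := by
  -- A conflation gluing these pushouts receives the given conflations, so its middle term is their
  -- coproduct and it is isomorphic to `f`, `g`.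
  obtain ⟨x, hx⟩ := H fun j => pushExt (α j) (hs j).ext
  obtain ⟨X', f', g', h, rfl⟩ := x.exists_rep
  choose b hb₁ hb₂ using fun j => (mor_iff rfl rfl).1
    (mor_iff_pushExt_eq_pullExt.2 (hx j).symm)
  obtain ⟨e, he⟩ := (Conf.isCoprod_mid hs h hα hζ hb₁ hb₂).exists_iso hξ
  refine h.iso (Iso.refl _) e (Iso.refl _) (hα.hom_ext fun j => ?_) ?_
  · rw [← reassoc_of% hb₁ j, he, hf, Iso.refl_hom, Category.id_comp]
  · refine (Conf.isCoprod_mid hs h hα hζ hb₁ hb₂).hom_ext fun j => ?_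
    rw [Iso.refl_hom, Category.comp_id, reassoc_of% he, hg, hb₂]

end Coproducts

end ExactStructure

section Tau

variable {C : Type u} [Category.{v} C] (G : Cᵒᵖ × C ⥤ AddCommGrpCat.{max v w})

theorem isIso_tau_iff (I : Type v) [HasCoproductsOfShape I C] :
    IsIso (tau.{w} G I) ↔ ∀ (Z : Discrete I ⥤ C) (A : C), Function.Bijective
      fun (x : G.obj (op (colimit Z), A)) (i : I) => pull G (colimit.ι Z ⟨i⟩) A x := by
  rw [NatTrans.isIso_iff_isIso_app]
  constructor
  · intro h Z A
    exact (ConcreteCategory.isIso_iff_bijective _).1 (h (op Z, A))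
  · rintro h ⟨Z, A⟩
    exact (ConcreteCategory.isIso_iff_bijective _).2 (h Z.unop A)

end Tau

/-- The AET conditions concern only non-empty index sets; the empty coproduct comes from finite
coproducts. -/
theorem hasCoproducts_of_nonempty {C : Type u} [Category.{v} C] [HasFiniteCoproducts C]
    (h : ∀ (I : Type v) [Nonempty I], HasCoproductsOfShape I C) : HasCoproducts.{v} C := by
  intro I
  cases isEmpty_or_nonempty I
  · infer_instance
  · exact h I

/-- An extriangulated functor is `(S₁, S₂)`-extriangulated for all `S₁` and `S₂`. -/
def ExtriangulatedFunctor.along {C : Type u} [Category.{v} C] [Preadditive C]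
    {D : Type u₁} [Category.{v₁} D]
    [Preadditive D] {𝓒 : Extriangulated.{w} C} {𝓓 : Extriangulated.{w} D} {T : C ⥤ D}
    (hT : ExtriangulatedFunctor 𝓒 𝓓 T) {X : Type u₂} [Category.{v₂} X] {Y : Type u₃}
    [Category.{v₃} Y] (S₁ : X ⥤ C) (S₂ : Y ⥤ C) : ExtriangulatedAlong 𝓒 𝓓 T S₁ S₂ where
  additive := hT.additive
  Γ := Functor.whiskerLeft (S₁.op.prod S₂) hT.Γ
  s_Γ x := hT.s_Γ x

namespace ExactStructure

variable {C : Type u} [Category.{v} C] [Preadditive C] {𝓔 : ExactStructure C} {I : Type v}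

/-- If `x` is realized by the coproduct of realizations of the extensions `y i`, then the
inclusions define morphisms of extensions from `y i` to `x`. -/
theorem mor_colimit_ι [HasCoproductsOfShape I C] {Z A : Discrete I ⥤ C}
    {y : ∀ i : I, 𝓔.Ext (Z.obj ⟨i⟩) (A.obj ⟨i⟩)} {x : 𝓔.Ext (colimit Z) (colimit A)}
    (hx : x.1 = (SeqClass.pi fun i => (y i).1).map (colim : (Discrete I ⥤ C) ⥤ C)) (i : I) :
    Mor (colimit.ι A ⟨i⟩) (colimit.ι Z ⟨i⟩) (y i) x := by
  obtain ⟨X, f, g, h⟩ := SeqClass.exists_rep (SeqClass.pi fun i => (y i).1)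
  rw [h, SeqClass.map_mk] at hx
  exact (mor_iff ((SeqClass.pi_eq_mk_iff _ _ _).1 h i) hx).2
    ⟨colimit.ι X ⟨i⟩, (ι_colimMap f _).symm, ι_colimMap g _⟩

/-! ### The coproduct of extensions, constructed from gluing -/

section Glue

variable [HasCoproductsOfShape I C]
  (H : ∀ (Z : Discrete I ⥤ C) (A : C) (y : ∀ i : I, 𝓔.Ext (Z.obj ⟨i⟩) A),
    ∃ x : 𝓔.Ext (colimit Z) A, ∀ i : I, pullExt (colimit.ι Z ⟨i⟩) x = y i)

/-- The coproduct of a family of extensions: the extension whose restrictions are the pushouts of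
the given ones. -/
noncomputable def colimExt {Z A : Discrete I ⥤ C}
    (y : ∀ i : I, 𝓔.Ext (Z.obj ⟨i⟩) (A.obj ⟨i⟩)) : 𝓔.Ext (colimit Z) (colimit A) :=
  (H Z (colimit A) fun i => pushExt (colimit.ι A ⟨i⟩) (y i)).choose

theorem pullExt_colimExt {Z A : Discrete I ⥤ C} (y : ∀ i : I, 𝓔.Ext (Z.obj ⟨i⟩) (A.obj ⟨i⟩))
    (i : I) : pullExt (colimit.ι Z ⟨i⟩) (colimExt H y) = pushExt (colimit.ι A ⟨i⟩) (y i) :=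
  (H Z (colimit A) fun i => pushExt (colimit.ι A ⟨i⟩) (y i)).choose_spec i

variable [HasBinaryBiproducts C]

/-- Additivity, and naturality in `colimExt_act`, are checked on the restrictions to the summands,
which suffices by injectivity of τ. -/
theorem colimExt_add {Z A : Discrete I ⥤ C} (y y' : ∀ i : I, 𝓔.Ext (Z.obj ⟨i⟩) (A.obj ⟨i⟩)) :
    colimExt H (y + y') = colimExt H y + colimExt H y' :=
  ext_coprod_ext (isCoprod_colimit Z) fun i => by
    rw [pullExt_add, pullExt_colimExt, pullExt_colimExt, pullExt_colimExt, ← pushExt_add]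
    rfl

theorem colimExt_act {Z Z' A A' : Discrete I ⥤ C} (c : Z' ⟶ Z) (a : A ⟶ A')
    (y : ∀ i : I, 𝓔.Ext (Z.obj ⟨i⟩) (A.obj ⟨i⟩)) :
    colimExt H (fun i => pushExt (a.app ⟨i⟩) (pullExt (c.app ⟨i⟩) (y i))) =
      pushExt (colim.map a) (pullExt (colim.map c) (colimExt H y)) :=
  ext_coprod_ext (isCoprod_colimit Z') fun i => by
    rw [pullExt_colimExt, ← pushExt_pullExt, pullExt_pullExt, colimit.ι_map, ← pullExt_pullExt,
      pullExt_colimExt, pushExt_pushExt, ← pushExt_pullExt, pushExt_pushExt, colimit.ι_map]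

/-- The coproduct of the realizations is a conflation by `conf_coprod`, and its class has the
restrictions that characterize `colimExt`. -/
theorem colimExt_val {Z A : Discrete I ⥤ C} (y : ∀ i : I, 𝓔.Ext (Z.obj ⟨i⟩) (A.obj ⟨i⟩)) :
    (colimExt H y).1 = (SeqClass.pi fun i => (y i).1).map (colim : (Discrete I ⥤ C) ⥤ C) := by
  obtain ⟨X, f, g, h⟩ := SeqClass.exists_rep (SeqClass.pi fun i => (y i).1)
  choose hc hy using fun i => Ext.exists_conf ((SeqClass.pi_eq_mk_iff _ _ _).1 h i)
  have hs : 𝓔.Conf (colim.map f) (colim.map g) :=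
    conf_coprod hc (isCoprod_colimit A) (isCoprod_colimit X) (isCoprod_colimit Z)
      (fun i => (colimit.ι_map f _).symm) (fun i => colimit.ι_map g _) (H Z _)
  rw [h, SeqClass.map_mk]
  have : colimExt H y = hs.ext := ext_coprod_ext (isCoprod_colimit Z) fun i => by
    rw [pullExt_colimExt, ← mor_iff_pushExt_eq_pullExt, hy i]
    exact (mor_iff rfl rfl).2 ⟨colimit.ι X ⟨i⟩, (colimit.ι_map f _).symm, colimit.ι_map g _⟩
  rw [this]
  rfl

end Glue

/-! ### The equivalence of the five conditions -/

variable [HasFiniteBiproducts C]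

attribute [local instance] hasBinaryBiproducts_of_finite_biproducts

/-- Only surjectivity is at stake, injectivity being `ext_coprod_ext`. -/
theorem isIso_tau_iff_glue [HasCoproductsOfShape I C] :
    IsIso (tau.{u} 𝓔.extriangulated.E I) ↔ ∀ (Z : Discrete I ⥤ C) (A : C)
      (y : ∀ i : I, 𝓔.Ext (Z.obj ⟨i⟩) A),
        ∃ x : 𝓔.Ext (colimit Z) A, ∀ i : I, pullExt (colimit.ι Z ⟨i⟩) x = y i := by
  rw [isIso_tau_iff]
  constructor
  · intro h Z A y
    obtain ⟨x, hx⟩ := (h Z A).2 y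
    exact ⟨x, fun i => (pull_extFunctor _ _).symm.trans (congrFun hx i)⟩
  · intro h Z A
    refine ⟨fun x x' hx => ext_coprod_ext (𝓔 := 𝓔) (isCoprod_colimit Z) fun i => ?_, fun y => ?_⟩
    · exact (pull_extFunctor _ _).symm.trans ((congrFun hx i).trans (pull_extFunctor _ _))
    · obtain ⟨x, hx⟩ := h Z A y
      exact ⟨x, funext fun i => (pull_extFunctor _ _).trans (hx i)⟩

/-- The realization clause makes `Γ(y)` an extension that receives a morphism from each `y i`;
folding `A^(I)` onto `A` then glues the family. -/
theorem isIso_tau_of_aet35On (h : AET35On.{u} 𝓔.extriangulated I) :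
    ∃ _ : HasCoproductsOfShape I C, IsIso (tau.{u} 𝓔.extriangulated.E I) := by
  obtain ⟨hI, ⟨hS⟩⟩ := h
  refine ⟨hI, isIso_tau_iff_glue.2 fun Z A y => ?_⟩
  exact exists_glue (isCoprod_colimit _)
    (mor_colimit_ι (A := (Functor.const (Discrete I)).obj A) (hS.s_Γ (Z := Z) (A := A) y))

theorem isIso_tau_of_conf_sigma [HasCoproductsOfShape I C]
    (H : ∀ (A X Z : I → C) (f : ∀ i, A i ⟶ X i) (g : ∀ i, X i ⟶ Z i),
      (∀ i, 𝓔.Conf (f i) (g i)) → 𝓔.Conf (Limits.Sigma.map f) (Limits.Sigma.map g)) :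
    IsIso (tau.{u} 𝓔.extriangulated.E I) := by
  refine isIso_tau_iff_glue.2 fun Z A y => ?_
  choose X f g h hy using fun i => (y i).exists_rep
  have hc := H (fun _ => A) X (fun i => Z.obj ⟨i⟩) f g h
  -- `H` speaks of the coproduct of the family of objects, τ of the colimit of the functor `Z`; `e`
  -- compares the two.
  obtain ⟨e, he⟩ := (isCoprod_colimit (Discrete.functor fun i : I => Z.obj ⟨i⟩)).exists_iso
    (isCoprod_colimit Z)
  have hc' : 𝓔.Conf (Limits.Sigma.map f) (Limits.Sigma.map g ≫ e.hom) :=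
    hc.iso (Iso.refl _) (Iso.refl _) e (by simp) (by simp)
  refine exists_glue (isCoprod_colimit (Discrete.functor fun _ : I => A)) (x := hc'.ext)
    fun i => ?_
  rw [hy]
  refine (mor_iff rfl rfl).2 ⟨Limits.Sigma.ι X i, (Sigma.ι_map f i).symm, ?_⟩
  rw [← he]
  exact Sigma.ι_map_assoc g i e.hom

/-- The family of classes is one extension in `Fun(I, C)`, realized componentwise. Its image under
`Γ` is realized by the coproduct sequence, and whatever realizes an element of `Ext` is a
conflation. -/
theorem conf_sigma_of_extriangulatedFunctor [HasCoproductsOfShape I C]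
    (hS : ExtriangulatedFunctor (𝓔.extriangulated.pi I) 𝓔.extriangulated
      (colim : (Discrete I ⥤ C) ⥤ C)) (A X Z : I → C) (f : ∀ i, A i ⟶ X i)
    (g : ∀ i, X i ⟶ Z i) (h : ∀ i, 𝓔.Conf (f i) (g i)) :
    𝓔.Conf (Limits.Sigma.map f) (Limits.Sigma.map g) := by
  have hx := hS.s_Γ (Z := Discrete.functor Z) (A := Discrete.functor A) fun i => (h i).ext
  have hy : (𝓔.extriangulated.pi I).s (Z := Discrete.functor Z) (A := Discrete.functor A)
      (fun i => (h i).ext) = SeqClass.mk (X := Discrete.functor X)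
        (Discrete.natTrans fun i => f i.as : Discrete.functor A ⟶ Discrete.functor X)
        (Discrete.natTrans fun i => g i.as : Discrete.functor X ⟶ Discrete.functor Z) :=
    (SeqClass.pi_eq_mk_iff _ _ _).2 fun i => rfl
  rw [hy] at hx
  exact (Ext.exists_conf hx).1

/-- The compatibility with the unit says, in each component, that the inclusions are a morphism of
extensions from `x i` to `Γ(x)`; the inclusion of the middle terms realizes it. -/
theorem aet4On_of_extriangulatedFunctor [hI : HasCoproductsOfShape I C]
    (hS : ExtriangulatedFunctor (𝓔.extriangulated.pi I) 𝓔.extriangulated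
      (colim : (Discrete I ⥤ C) ⥤ C)) : AET4On.{u} 𝓔.extriangulated I := by
  refine ⟨hI, hS.along _ _, fun Z A x => funext fun i => ?_⟩
  exact push_eq_pull_iff.2 (mor_colimit_ι (A := (Functor.const (Discrete I)).obj A)
    (hS.s_Γ (Z := Z) (A := (Functor.const (Discrete I)).obj A) x) i)

/-- If extensions of coproducts are determined by arbitrary families of restrictions, then the
coproduct functor is extriangulated. -/
noncomputable def colimExtriangulated [HasCoproductsOfShape I C]
    (H : ∀ (Z : Discrete I ⥤ C) (A : C) (y : ∀ i : I, 𝓔.Ext (Z.obj ⟨i⟩) A),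
      ∃ x : 𝓔.Ext (colimit Z) A, ∀ i : I, pullExt (colimit.ι Z ⟨i⟩) x = y i) :
    ExtriangulatedFunctor (𝓔.extriangulated.pi I) 𝓔.extriangulated
      (colim : (Discrete I ⥤ C) ⥤ C) where
  additive := ⟨fun {Z Z' f g} => colimit.hom_ext fun i => by
    simp [Preadditive.comp_add, Preadditive.add_comp]⟩
  Γ :=
    { app := fun P => AddCommGrpCat.ofHom (AddMonoidHom.mk' (colimExt H) (colimExt_add H))
      naturality := fun P Q f => by
        ext y
        exact colimExt_act H f.1.unop f.2 y }
  s_Γ y := colimExt_val H y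

theorem tfae_aet4 : List.TFAE [
      IsAET4.{u} 𝓔.extriangulated,
      IsAET35.{u} 𝓔.extriangulated,
      ∃ _ : HasCoproducts.{v} C, ∀ (I : Type v) [Nonempty I],
        Nonempty (ExtriangulatedFunctor (𝓔.extriangulated.pi I) 𝓔.extriangulated
          (colim : (Discrete I ⥤ C) ⥤ C)),
      ∃ _ : HasCoproducts.{v} C, ∀ (I : Type v) [Nonempty I] (A X Z : I → C)
        (f : ∀ i, A i ⟶ X i) (g : ∀ i, X i ⟶ Z i), (∀ i, 𝓔.Conf (f i) (g i)) →
          𝓔.Conf (Limits.Sigma.map f) (Limits.Sigma.map g),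
      ∃ _ : HasCoproducts.{v} C, ∀ (I : Type v) [Nonempty I],
        IsIso (tau.{u} 𝓔.extriangulated.E I)] := by
  tfae_have 1 → 2 := fun h I _ => by
    obtain ⟨hI, hS, -⟩ := h I
    exact ⟨hI, ⟨hS⟩⟩
  tfae_have 2 → 5 := fun h =>
    ⟨hasCoproducts_of_nonempty fun I _ => (h I).1,
      fun I _ => (isIso_tau_of_aet35On (h I)).2⟩
  tfae_have 5 → 3 := fun ⟨hC, h⟩ =>
    ⟨hC, fun I _ => ⟨colimExtriangulated (isIso_tau_iff_glue.1 (h I))⟩⟩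
  tfae_have 3 → 1 := fun ⟨hC, h⟩ I _ => aet4On_of_extriangulatedFunctor (h I).some
  tfae_have 3 → 4 := fun ⟨hC, h⟩ =>
    ⟨hC, fun I _ => conf_sigma_of_extriangulatedFunctor (h I).some⟩
  tfae_have 4 → 5 := fun ⟨hC, h⟩ => ⟨hC, fun I _ => isIso_tau_of_conf_sigma (h I)⟩
  tfae_finish

end ExactStructure

/-! ### Calculus of the products `x · y` -/

section Products

variable {C : Type u} [Category.{v} C]

theorem pull_id (G : Cᵒᵖ × C ⥤ AddCommGrpCat.{w}) {Z A : C} (x : G.obj (op Z, A)) :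
    pull G (𝟙 Z) A x = x :=
  act_id G x

theorem pull_pull (G : Cᵒᵖ × C ⥤ AddCommGrpCat.{w}) {Z Z' Z'' A : C} (c : Z' ⟶ Z)
    (c' : Z'' ⟶ Z') (x : G.obj (op Z, A)) :
    pull G c' A (pull G c A x) = pull G (c' ≫ c) A x := by
  refine (act_comp G _ _ _ _ _).trans ?_
  rw [Category.comp_id]
  rfl

/-- The bifunctor `G` is additive in the first variable. -/
def PullAdditive [Preadditive C] (G : Cᵒᵖ × C ⥤ AddCommGrpCat.{w}) : Prop :=
  ∀ {Z Z' A : C} (c c' : Z' ⟶ Z) (x : G.obj (op Z, A)),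
    pull G (c + c') A x = pull G c A x + pull G c' A x

theorem PullAdditive.zero [Preadditive C] {G : Cᵒᵖ × C ⥤ AddCommGrpCat.{w}} (hG : PullAdditive G)
    {Z Z' A : C} (x : G.obj (op Z, A)) : pull G (0 : Z' ⟶ Z) A x = 0 := by
  have h := hG (0 : Z' ⟶ Z) 0 x
  rwa [add_zero, left_eq_add] at h

variable {G E : Cᵒᵖ × C ⥤ AddCommGrpCat.{max u v}}

/-- The product `x · y` of `x ∈ G(M, A)` and `y ∈ E(Z, M)`. -/
def splice {Z M A : C} (x : G.obj (op M, A)) (y : E.obj (op Z, M)) :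
    (productFunctor.{v} G E).obj (op Z, A) :=
  (QuotientAddGroup.mk (FreeAbelianGroup.of ⟨M, x, y⟩) : ProductGroup.{v} G E Z A)

theorem mk_eq_of_rel {Z A : C} {s t : FreeAbelianGroup (FormalProduct.{v} G E Z A)}
    (h : ProductRel.{v} G E Z A (s - t)) :
    (QuotientAddGroup.mk s : ProductGroup.{v} G E Z A) = QuotientAddGroup.mk t :=
  QuotientAddGroup.eq_iff_sub_mem.2 (AddSubgroup.subset_closure h)

theorem splice_add_left {Z M A : C} (x x' : G.obj (op M, A)) (y : E.obj (op Z, M)) :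
    splice (x + x') y = splice x y + splice x' y :=
  mk_eq_of_rel (.add_left M x x' y)

theorem splice_add_right {Z M A : C} (x : G.obj (op M, A)) (y y' : E.obj (op Z, M)) :
    splice x (y + y') = splice x y + splice x y' :=
  mk_eq_of_rel (.add_right M x y y')

theorem splice_pull {Z M M' A : C} (m : M ⟶ M') (x : G.obj (op M', A)) (y : E.obj (op Z, M)) :
    splice (pull G m A x) y = splice x (push E Z m y) :=
  mk_eq_of_rel (.balance m x y)

theorem pull_splice {Z Z' M A : C} (c : Z' ⟶ Z) (x : G.obj (op M, A)) (y : E.obj (op Z, M)) :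
    pull (productFunctor.{v} G E) c A (splice x y) = splice x (pull E c M y) := by
  have : push G M (𝟙 A) x = x := act_id G x
  exact congrArg (fun t => splice t (pull E c M y)) this

theorem splice_zero_left {Z M A : C} (y : E.obj (op Z, M)) :
    splice (0 : G.obj (op M, A)) y = 0 := by
  have h := splice_add_left (0 : G.obj (op M, A)) 0 y
  rwa [add_zero, left_eq_add] at h

theorem splice_zero_right {Z M A : C} (x : G.obj (op M, A)) :
    splice x (0 : E.obj (op Z, M)) = 0 := by
  have h := splice_add_right x (0 : E.obj (op Z, M)) 0
  rwa [add_zero, left_eq_add] at h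

theorem splice_neg_left {Z M A : C} (x : G.obj (op M, A)) (y : E.obj (op Z, M)) :
    splice (-x) y = -splice x y := by
  rw [eq_neg_iff_add_eq_zero, ← splice_add_left, neg_add_cancel, splice_zero_left]

/-- A row `(x, x')` times a column `(y, y')` through `M ⊞ M'`: the cross terms contain a zero
morphism. This is why sums of products are again products. -/
theorem splice_add_splice [Preadditive C] [HasBinaryBiproducts C] (hG : PullAdditive G)
    {Z M M' A : C} (x : G.obj (op M, A)) (y : E.obj (op Z, M)) (x' : G.obj (op M', A))
    (y' : E.obj (op Z, M')) :
    splice (pull G (biprod.fst : M ⊞ M' ⟶ M) A x + pull G biprod.snd A x')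
      (push E Z biprod.inl y + push E Z biprod.inr y') = splice x y + splice x' y' := by
  simp only [splice_add_right, ← splice_pull, map_add, pull_pull, biprod.inl_fst,
    biprod.inl_snd, biprod.inr_fst, biprod.inr_snd, pull_id, hG.zero, add_zero,
    zero_add]

/-- Every element of the product of two bifunctors is a product. -/
theorem exists_splice [Preadditive C] [HasBinaryBiproducts C] (hG : PullAdditive G) {Z A : C}
    (ξ : (productFunctor.{v} G E).obj (op Z, A)) :
    ∃ (M : C) (x : G.obj (op M, A)) (y : E.obj (op Z, M)), ξ = splice x y := by
  obtain ⟨t, rfl⟩ := QuotientAddGroup.mk_surjective ξ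
  induction t using FreeAbelianGroup.induction_on with
  | zero => exact ⟨A, 0, 0, (splice_zero_left _).symm⟩
  | of s => exact ⟨s.1, s.2.1, s.2.2, rfl⟩
  | neg s _ => exact ⟨s.1, -s.2.1, s.2.2, (splice_neg_left _ _).symm⟩
  | add s t hs ht =>
    obtain ⟨M, x, y, h⟩ := hs
    obtain ⟨M', x', y', h'⟩ := ht
    exact ⟨_, _, _, (congrArg₂ (· + ·) h h').trans (splice_add_splice hG x y x' y').symm⟩

theorem pullAdditive_productFunctor [Preadditive C] [HasBinaryBiproducts C]
    (hG : PullAdditive G) (hE : PullAdditive E) : PullAdditive (productFunctor.{v} G E) := by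
  intro Z Z' A c c' ξ
  obtain ⟨M, x, y, rfl⟩ := exists_splice hG ξ
  rw [pull_splice, pull_splice, pull_splice, hE, splice_add_right]

end Products

namespace ExactStructure

variable {C : Type u} [Category.{v} C] [Preadditive C] {𝓔 : ExactStructure C}

/-- The composite of deflations, with the conflations it is involved in. -/
theorem Conf.exists_comp {L P X Z M : C} {j : L ⟶ P} {q : P ⟶ X} {i : M ⟶ X} {p : X ⟶ Z}
    (h : 𝓔.Conf j q) (h' : 𝓔.Conf i p) : ∃ (K : C) (k : K ⟶ P) (a : K ⟶ M) (l : L ⟶ K),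
      𝓔.Conf k (q ≫ p) ∧ 𝓔.Conf l a ∧ k ≫ q = a ≫ i ∧ l ≫ k = j := by
  obtain ⟨K, k, l, a, hK, hl, hc⟩ := h.exists_pullback i
  have := h'.mono
  have : Mono k := by
    refine Preadditive.mono_of_cancel_zero k fun {T} t ht => hK.hom_ext (by simpa using ht) ?_
    rw [← cancel_mono i, Category.assoc, ← hK.w, reassoc_of% ht]
    simp
  refine ⟨K, k, a, l, conf_of_deflation (𝓔.comp_deflation q p h.deflation h'.deflation) ?_ ?_,
    hc, hK.w, hl⟩
  · rw [reassoc_of% hK.w, h'.zero, comp_zero]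
  · intro T t ht
    obtain ⟨r, hr⟩ := h'.lift (t ≫ q) (by simpa using ht)
    exact ⟨hK.lift t r hr.symm, hK.lift_fst _ _ _⟩

variable [HasBinaryBiproducts C]

theorem mor_push {Z A A' : C} (a : A ⟶ A') (x : 𝓔.Ext Z A) :
    Mor (𝓔 := 𝓔) a (𝟙 Z) x (push 𝓔.extFunctor Z a x) := by
  rw [push_extFunctor]
  exact mor_pushExt a x

theorem pullAdditive_extFunctor : PullAdditive 𝓔.extFunctor := by
  intro Z Z' A c c' x
  refine (pull_extFunctor _ _).trans ((pullExt_add_left c c' x).trans ?_)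
  exact congrArg₂ (· + ·) (pull_extFunctor c x).symm (pull_extFunctor c' x).symm

variable (𝓔) in
/-- The functors `G(-, A)` are half exact on the conflations. -/
def HalfExact (G : Cᵒᵖ × C ⥤ AddCommGrpCat.{w}) : Prop :=
  ∀ {M X Z A : C} {i : M ⟶ X} {p : X ⟶ Z}, 𝓔.Conf i p → ∀ x : G.obj (op X, A),
    pull G i A x = 0 → ∃ z : G.obj (op Z, A), pull G p A z = x

/-! ### Detecting non-zero products -/

section Dominated

variable {G : Cᵒᵖ × C ⥤ AddCommGrpCat.{max u v}} {A K P Z : C} {k : K ⟶ P} {q : P ⟶ Z}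

open Classical in
/-- For a conflation `K ⟶ P ⟶ Z`, the map which sends a formal product `x · y`, where `y` is the
pushout of the conflation along `a`, to the class of `x · a` in the cokernel of
`G(P, A) → G(K, A)`. -/
noncomputable def Conf.cokerMap (G : Cᵒᵖ × C ⥤ AddCommGrpCat.{max u v}) (h : 𝓔.Conf k q) (A : C) :
    FreeAbelianGroup (FormalProduct.{v} G 𝓔.extFunctor Z A) →+
      G.obj (op K, A) ⧸ (pull G k A).range :=
  FreeAbelianGroup.lift fun s =>
    -- The value 0 on the other generators only makes the map total. The defining relations are
    -- treated one element at a time, for suitable `h`, in `exists_dominating`.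
    if H : ∃ a : K ⟶ s.1, Mor (𝓔 := 𝓔) a (𝟙 Z) h.ext s.2.2 then
      QuotientAddGroup.mk (pull G H.choose A s.2.1) else 0

/-- The chosen `a` is irrelevant: if two morphisms push the conflation to the same `y`, the maps on
middle terms differ by a map through the kernel `M`, so the two morphisms differ by one that factors
through `k`. That changes `x · a` by an element of the range of `pull G k A`. -/
theorem Conf.cokerMap_of (h : 𝓔.Conf k q) (hG : PullAdditive G) {M : C} {a : K ⟶ M}
    {y : 𝓔.Ext Z M} (ha : Mor a (𝟙 Z) h.ext y) (x : G.obj (op M, A)) :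
    h.cokerMap G A (FreeAbelianGroup.of ⟨M, x, y⟩) = QuotientAddGroup.mk (pull G a A x) := by
  have H : ∃ a : K ⟶ M, Mor (𝓔 := 𝓔) a (𝟙 Z) h.ext y := ⟨a, ha⟩
  have h₁ : h.cokerMap G A (FreeAbelianGroup.of ⟨M, x, y⟩) =
      QuotientAddGroup.mk (pull G H.choose A x) := by
    rw [Conf.cokerMap, FreeAbelianGroup.lift_apply_of, dif_pos H]
  rw [h₁, QuotientAddGroup.eq_iff_sub_mem]
  have hb := H.choose_spec
  set b := H.choose
  obtain ⟨X, i, p, hy, rfl⟩ := y.exists_rep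
  obtain ⟨m, hm₁, hm₂⟩ := (mor_iff rfl rfl).1 ha
  obtain ⟨n, hn₁, hn₂⟩ := (mor_iff rfl rfl).1 hb
  have := hy.mono
  obtain ⟨l, hl⟩ := hy.lift (n - m) (by rw [Preadditive.sub_comp, hm₂, hn₂, sub_self])
  have hba : b = a + k ≫ l := by
    rw [← cancel_mono i, Preadditive.add_comp, Category.assoc, hl, Preadditive.comp_sub, hm₁, hn₁,
      add_sub_cancel]
  exact ⟨pull G l A x, by rw [pull_pull, hba, hG, add_sub_cancel_left]⟩

/-- An element of the relation subgroup is built from finitely many relations, so finitely many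
extensions of `Z` occur in them. Collecting these as components of one extension `y` ensures that,
once `y` is a pushout of `h`, so are all of them. Then `cokerMap_of` computes every term and the
relations cancel. -/
theorem exists_dominating (hG : PullAdditive G)
    {t : FreeAbelianGroup (FormalProduct.{v} G 𝓔.extFunctor Z A)}
    (ht : t ∈ AddSubgroup.closure {t | ProductRel.{v} G 𝓔.extFunctor Z A t}) :
    ∃ (N : C) (y : 𝓔.Ext Z N), ∀ {K P : C} {k : K ⟶ P} {q : P ⟶ Z} (h : 𝓔.Conf k q) (a : K ⟶ N),
      Mor a (𝟙 Z) h.ext y → h.cokerMap G A t = 0 := by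
  induction ht using AddSubgroup.closure_induction with
  | mem t ht =>
    cases ht with
    | add_left M x x' y =>
      refine ⟨M, y, fun h a ha => ?_⟩
      rw [map_sub, map_add, h.cokerMap_of hG ha, h.cokerMap_of hG ha, h.cokerMap_of hG ha, map_add,
        QuotientAddGroup.mk_add, sub_self]
    | add_right M x y y' =>
      -- The two components of `a` push `h` to `y` and `y'`, and their sum pushes it to the Baer
      -- sum.
      refine ⟨M ⊞ M, pairExt (𝓔 := 𝓔) y y', fun h a ha => ?_⟩
      have h₁ := ha.comp (mor_pairExt_fst y y')
      have h₂ := ha.comp (mor_pairExt_snd y y')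
      rw [Category.comp_id] at h₁ h₂
      have h₃ := h.cokerMap_of hG (h₁.add h₂) x
      rw [hG] at h₃
      rw [map_sub, map_add, h.cokerMap_of hG h₁, h.cokerMap_of hG h₂]
      exact sub_eq_zero.2 h₃
    | @balance M M' m x y =>
      refine ⟨M, y, fun h a ha => ?_⟩
      have h₁ := ha.comp (mor_push m y)
      rw [Category.comp_id] at h₁
      rw [map_sub, h.cokerMap_of hG ha, h.cokerMap_of hG h₁, pull_pull, sub_self]
  | zero => exact ⟨A, 0, fun h a _ => map_zero _⟩
  | add s t _ _ hs ht =>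
    obtain ⟨N, y, hy⟩ := hs
    obtain ⟨N', y', hy'⟩ := ht
    refine ⟨N ⊞ N', pairExt y y', fun h a ha => ?_⟩
    have h₁ := ha.comp (mor_pairExt_fst y y')
    have h₂ := ha.comp (mor_pairExt_snd y y')
    rw [Category.comp_id] at h₁ h₂
    rw [map_add, hy h _ h₁, hy' h _ h₂, add_zero]
  | neg t _ ht =>
    obtain ⟨N, y, hy⟩ := ht
    exact ⟨N, y, fun h a ha => by rw [map_neg, hy h a ha, neg_zero]⟩

end Dominated

/-! ### When a product with a conflation vanishes -/

section Exactness

variable {G : Cᵒᵖ × C ⥤ AddCommGrpCat.{max u v}}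

theorem Conf.splice_pull_eq_zero {A M X Z : C} {i : M ⟶ X} {p : X ⟶ Z} (h : 𝓔.Conf i p)
    (x : G.obj (op X, A)) : splice (E := 𝓔.extFunctor) (pull G i A x) h.ext = 0 := by
  have h0 : push 𝓔.extFunctor Z i h.ext = 0 :=
    (push_extFunctor _ _).trans ((h.pushExt_eq_zero_iff i).2 ⟨𝟙 X, Category.comp_id i⟩)
  exact (splice_pull _ _ _).trans ((congrArg (splice x) h0).trans (splice_zero_right x))

/-- The products `x · y` with a conflation `y` vanish only if `x` extends to the middle term. -/
theorem Conf.exists_of_splice_eq_zero (hG : PullAdditive G) (hG' : HalfExact 𝓔 G)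
    {A M X Z : C} {i : M ⟶ X} {p : X ⟶ Z} (h : 𝓔.Conf i p) {x : G.obj (op M, A)}
    (hx : splice (E := 𝓔.extFunctor) x h.ext = 0) : ∃ x' : G.obj (op X, A), pull G i A x' = x := by
  obtain ⟨N, y, hy⟩ := exists_dominating hG ((QuotientAddGroup.eq_zero_iff _).1 hx)
  obtain ⟨Y, i₀, p₀, h₀, rfl⟩ := y.exists_rep
  -- With `P` the pullback of the two middle terms over `Z`, the conflation `K ⟶ P ⟶ Z` has both `y`
  -- and `h.ext` as pushouts, along `a₀` and `a`. So the dominating property applies to it and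
  -- `cokerMap_of` evaluates the product.
  obtain ⟨P, b, j, q, hP, hj, hc⟩ := h₀.exists_pullback p
  obtain ⟨K, k, a, j', hK, hj', hka, hjk⟩ := hc.exists_comp h
  have := hK.mono
  have := h.mono
  obtain ⟨a₀, ha₀⟩ := h₀.lift (k ≫ b) (by
    rw [Category.assoc, hP.w, ← hK.zero])
  have m₀ : Mor a₀ (𝟙 Z) hK.ext h₀.ext := (mor_iff rfl rfl).2 ⟨b, ha₀.symm, by simp [hP.w]⟩
  have m : Mor a (𝟙 Z) hK.ext h.ext := (mor_iff rfl rfl).2 ⟨q, hka, by simp⟩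
  have hz := hy hK a₀ m₀
  rw [hK.cokerMap_of hG m, QuotientAddGroup.eq_zero_iff] at hz
  -- Now `x · a` extends to `x₁` on `P`. Since `a` kills `j'`, `x₁` vanishes on the kernel of `q`
  -- and descends to `X` by half exactness.
  obtain ⟨x₁, hx₁⟩ := hz
  obtain ⟨x₂, rfl⟩ := hG' hc x₁ (by
    rw [← hjk, ← pull_pull, hx₁, pull_pull, hj'.zero, hG.zero])
  -- The map `(0, i)` factors through `K` as a section of `a`; restricting `x · a = x₂ · (k ≫ q)`
  -- along it gives `x = x₂ · i`.
  obtain ⟨l, hl₁, hl₂⟩ : ∃ l : M ⟶ P, l ≫ b = 0 ∧ l ≫ q = i :=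
    ⟨hP.lift 0 i (by rw [h.zero, zero_comp]), hP.lift_fst _ _ _, hP.lift_snd _ _ _⟩
  obtain ⟨l', rfl⟩ := hK.lift l (by rw [reassoc_of% hl₂, h.zero])
  have hla : l' ≫ a = 𝟙 M := by
    rw [← cancel_mono i, Category.assoc, ← hka, ← Category.assoc, hl₂, Category.id_comp]
  refine ⟨x₂, ?_⟩
  rw [← pull_id G x, ← hla, ← pull_pull G a, ← hx₁, pull_pull, pull_pull, hl₂]

end Exactness

end ExactStructure

namespace ExactStructure

variable {C : Type u} [Category.{v} C] [Preadditive C]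
  {𝓔 : ExactStructure C} {G : Cᵒᵖ × C ⥤ AddCommGrpCat.{max u v}}

/-! ### Half exactness of the extension functors -/

section Connecting

variable [HasBinaryBiproducts C]

/-- Composing the deflation of `x` with `p` gives a conflation `K ⟶ Y ⟶ Z`, and the restriction of
`x` to `M` is `A ⟶ K ⟶ M`. If this splits, the pushout of the composite conflation along a
retraction `K ⟶ A` is an extension of `Z` that pulls back to `x`. -/
theorem halfExact_extFunctor : 𝓔.HalfExact 𝓔.extFunctor := by
  intro M X Z A i p h x hx
  obtain ⟨Y, j, q, hc, rfl⟩ := x.exists_rep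
  obtain ⟨K, k, a, l, hK, hl, hka, hlk⟩ := hc.exists_comp h
  have h₁ : Mor (𝟙 A) i hl.ext hc.ext := (mor_iff rfl rfl).2 ⟨k, by simp [hlk], hka⟩
  have h₂ : Mor l p hc.ext hK.ext := (mor_iff rfl rfl).2 ⟨𝟙 Y, by simp [hlk], by simp⟩
  obtain ⟨r, hr⟩ := (hl.pushExt_eq_zero_iff (𝟙 A)).1
    ((pushExt_id _).trans (h₁.eq_pullExt.trans ((pull_extFunctor _ _).symm.trans hx)))
  refine ⟨pushExt r hK.ext, (pull_extFunctor _ _).trans ?_⟩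
  rw [← pushExt_pullExt, ← mor_iff_pushExt_eq_pullExt.1 h₂, pushExt_pushExt, hr, pushExt_id]

/-- The same composite, with the retraction replaced by an extension `x'` of `x` to `K`, which
exists since `x · (y · i) = 0`. Then `x · y = (x' · l) · y = x' · (l · y)`, and `l · y` is the
restriction along `p` of `K ⟶ Y ⟶ Z`. -/
theorem halfExact_productFunctor (hG : PullAdditive G) (hG' : 𝓔.HalfExact G) :
    𝓔.HalfExact (productFunctor.{v} G 𝓔.extFunctor) := by
  intro M X Z A i p h ξ hξ
  obtain ⟨N, x, y, rfl⟩ := exists_splice hG ξ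
  obtain ⟨Y, j, q, hc, rfl⟩ := Ext.exists_rep (𝓔 := 𝓔) y
  obtain ⟨K, k, a, l, hK, hl, hka, hlk⟩ := hc.exists_comp h
  have h₁ : Mor (𝟙 N) i hl.ext hc.ext := (mor_iff rfl rfl).2 ⟨k, by simp [hlk], hka⟩
  have h₂ : Mor l p hc.ext hK.ext := (mor_iff rfl rfl).2 ⟨𝟙 Y, by simp [hlk], by simp⟩
  have h₃ : pull 𝓔.extFunctor i N hc.ext = hl.ext :=
    (pull_extFunctor _ _).trans h₁.eq_pullExt.symm
  obtain ⟨x', rfl⟩ := hl.exists_of_splice_eq_zero hG hG'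
    ((congrArg (splice x) h₃.symm).trans ((pull_splice _ _ _).symm.trans hξ))
  refine ⟨splice x' hK.ext, (pull_splice _ _ _).trans ?_⟩
  exact (congrArg (splice x') (push_eq_pull_iff.2 h₂).symm).trans (splice_pull _ _ _).symm

end Connecting

/-! ### The isomorphism τ for higher extensions -/

variable [HasFiniteBiproducts C] {I : Type v} [HasCoproductsOfShape I C]

attribute [local instance] hasBinaryBiproducts_of_finite_biproducts

/-- Each restriction of `y` has a middle term `X i` to which `x` extends, and these extensions glue
to `ξ` on `∐ X_i`. As `y` is the pushout along the codiagonal `d` of the coproduct conflation, `x ·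
y` is `x · d` times that conflation; `x · d` extends to `ξ`, so the product is zero. -/
theorem splice_eq_zero_of_colimit (hG : PullAdditive G) (hG' : 𝓔.HalfExact G)
    (hτ : IsIso (tau.{u} 𝓔.extriangulated.E I)) (hτ' : IsIso (tau.{u} G I)) {Z : Discrete I ⥤ C}
    {M A : C} (x : G.obj (op M, A)) (y : 𝓔.Ext (colimit Z) M)
    (hxy : ∀ i : I, splice (E := 𝓔.extFunctor) x (pullExt (colimit.ι Z ⟨i⟩) y) = 0) :
    splice (E := 𝓔.extFunctor) x y = 0 := by
  choose X f g h hy using fun i : I => (pullExt (colimit.ι Z ⟨i⟩) y).exists_rep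
  choose x' hx' using fun i => (h i).exists_of_splice_eq_zero hG hG'
    ((congrArg (splice x) (hy i).symm).trans (hxy i))
  obtain ⟨ξ, hξ⟩ := ((isIso_tau_iff G I).1 hτ' (Discrete.functor X) A).2 x'
  let φ : (Functor.const (Discrete I)).obj M ⟶ Discrete.functor X :=
    Discrete.natTrans fun i => f i.as
  let ψ : Discrete.functor X ⟶ Z := Discrete.natTrans fun i => g i.as
  have hs : 𝓔.Conf (colim.map φ) (colim.map ψ) :=
    conf_coprod h (isCoprod_colimit ((Functor.const (Discrete I)).obj M))
      (isCoprod_colimit (Discrete.functor X)) (isCoprod_colimit Z)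
      (fun i => (colimit.ι_map φ _).symm) (fun i => colimit.ι_map ψ _)
      (isIso_tau_iff_glue.1 hτ Z _)
  obtain ⟨d, hd⟩ := (isCoprod_colimit ((Functor.const (Discrete I)).obj M)).exists_desc
    fun _ => 𝟙 M
  have hyd : push 𝓔.extFunctor (colimit Z) d hs.ext = y := by
    refine (push_extFunctor _ _).trans (ext_coprod_ext (isCoprod_colimit Z) fun i => ?_)
    have hm : Mor (colimit.ι ((Functor.const (Discrete I)).obj M) ⟨i⟩) (colimit.ι Z ⟨i⟩)
        (h i).ext hs.ext := (mor_iff rfl rfl).2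
      ⟨colimit.ι (Discrete.functor X) ⟨i⟩, (colimit.ι_map φ _).symm, colimit.ι_map ψ _⟩
    rw [← pushExt_pullExt, ← mor_iff_pushExt_eq_pullExt.1 hm, pushExt_pushExt, hd, hy i]
    exact pushExt_id _
  -- Injectivity of τ for `G` reduces this to the summands of `M^(I)`, where both sides restrict to
  -- `x`.
  have hxd : pull G d A x = pull G (colim.map φ) A ξ :=
    ((isIso_tau_iff G I).1 hτ' _ A).1 <| funext fun i => by
      have h₁ : pull G (colimit.ι (Discrete.functor X) ⟨i⟩) A ξ = x' i := congrFun hξ i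
      have h₂ : pull G (colimit.ι ((Functor.const (Discrete I)).obj M) ⟨i⟩) A (pull G d A x) =
          x := by
        rw [pull_pull, hd]
        exact pull_id G x
      refine h₂.trans ?_
      dsimp only
      rw [pull_pull, colimit.ι_map, ← pull_pull, h₁]
      exact (hx' i).symm
  rw [← hyd]
  refine (splice_pull _ _ _).symm.trans ?_
  rw [hxd]
  exact hs.splice_pull_eq_zero ξ

theorem isIso_tau_productFunctor (hG : PullAdditive G) (hG' : 𝓔.HalfExact G)
    (hτ : IsIso (tau.{u} 𝓔.extriangulated.E I)) (hτ' : IsIso (tau.{u} G I)) :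
    IsIso (tau.{u} (productFunctor.{v} G 𝓔.extFunctor) I) := by
  refine (isIso_tau_iff _ I).2 fun Z A => ⟨fun ξ ξ' hξ => ?_, fun η => ?_⟩
  · rw [← sub_eq_zero]
    have hz : ∀ i : I, pull (productFunctor.{v} G 𝓔.extFunctor) (colimit.ι Z ⟨i⟩) A (ξ - ξ') = 0 :=
      fun i => by rw [map_sub, sub_eq_zero]; exact congrFun hξ i
    -- The difference is a single product, so the vanishing criterion applies.
    obtain ⟨M, x, y, h⟩ := exists_splice hG (ξ - ξ')
    rw [h] at hz ⊢
    refine splice_eq_zero_of_colimit hG hG' hτ hτ' x y fun i => ?_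
    exact (congrArg (splice x) (pull_extFunctor _ _).symm).trans
      ((pull_splice _ _ _).symm.trans (hz i))
  · choose M x y h using fun i => exists_splice hG (η i)
    obtain ⟨ξ, hξ⟩ := ((isIso_tau_iff G I).1 hτ' (Discrete.functor M) A).2 x
    -- The factors are glued over `∐ M_i`: the restriction of `ξ · w` to `Z_i` is `ξ · (μ_i · y_i) =
    -- (ξ · μ_i) · y_i = x_i · y_i`.
    obtain ⟨w, hw⟩ := isIso_tau_iff_glue.1 hτ Z (colimit (Discrete.functor M)) fun i =>
      pushExt (colimit.ι (Discrete.functor M) ⟨i⟩) (y i)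
    refine ⟨splice ξ w, funext fun i => ?_⟩
    have h₁ : pull 𝓔.extFunctor (colimit.ι Z ⟨i⟩) (colimit (Discrete.functor M)) w =
        push 𝓔.extFunctor (Z.obj ⟨i⟩) (colimit.ι (Discrete.functor M) ⟨i⟩) (y i) :=
      (pull_extFunctor _ _).trans ((hw i).trans (push_extFunctor _ _).symm)
    have h₂ : pull G (colimit.ι (Discrete.functor M) ⟨i⟩) A ξ = x i := congrFun hξ i
    refine (pull_splice _ _ _).trans ((congrArg (splice ξ) h₁).trans ?_)
    refine (splice_pull _ _ _).symm.trans (Eq.trans ?_ (h i).symm)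
    exact congrArg (fun t => splice t (y i)) h₂

theorem extSucc_pullAdditive_halfExact (n : ℕ) : PullAdditive (extSucc.{v} 𝓔.extFunctor n) ∧
    𝓔.HalfExact (extSucc.{v} 𝓔.extFunctor n) := by
  induction n with
  | zero => exact ⟨pullAdditive_extFunctor, halfExact_extFunctor⟩
  | succ n ih => exact ⟨pullAdditive_productFunctor ih.1 pullAdditive_extFunctor,
      halfExact_productFunctor ih.1 ih.2⟩

theorem isIso_tau_extSucc (hτ : IsIso (tau.{u} 𝓔.extriangulated.E I)) (n : ℕ) :
    IsIso (tau.{u} (extSucc.{v} 𝓔.extriangulated.E n) I) := by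
  induction n with
  | zero => exact hτ
  | succ n ih =>
    obtain ⟨h₁, h₂⟩ := extSucc_pullAdditive_halfExact (𝓔 := 𝓔) n
    exact isIso_tau_productFunctor h₁ h₂ hτ ih

end ExactStructure

end Extri

theorem mainTheorem6 {C : Type u} [Category.{v} C] [Preadditive C] [HasFiniteBiproducts C]
    (𝓔 : Extri.ExactStructure C) (hE : 𝓔.IsExtSmall) :
    List.TFAE [
      Extri.IsAET4.{u} 𝓔.extriangulated,
      Extri.IsAET35.{u} 𝓔.extriangulated,
      ∃ _ : HasCoproducts.{v} C, ∀ (I : Type v) [Nonempty I],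
        Nonempty (Extri.ExtriangulatedFunctor (𝓔.extriangulated.pi I) 𝓔.extriangulated
          (colim : (Discrete I ⥤ C) ⥤ C)),
      ∃ _ : HasCoproducts.{v} C, ∀ (I : Type v) [Nonempty I] (A X Z : I → C)
        (f : ∀ i, A i ⟶ X i) (g : ∀ i, X i ⟶ Z i), (∀ i, 𝓔.Conf (f i) (g i)) →
          𝓔.Conf (Limits.Sigma.map f) (Limits.Sigma.map g),
      ∃ _ : HasCoproducts.{v} C, ∀ (I : Type v) [Nonempty I],
        IsIso (Extri.tau.{u} 𝓔.extriangulated.E I)] ∧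
    (Extri.IsAET4.{u} 𝓔.extriangulated →
      ∃ _ : HasCoproducts.{v} C, ∀ (n : ℕ) (I : Type v) [Nonempty I],
        IsIso (Extri.tau.{u} (Extri.extSucc.{v} 𝓔.extriangulated.E n) I)) := by
  refine ⟨Extri.ExactStructure.tfae_aet4, fun h => ?_⟩
  -- Positions count from zero: this is (a) implies (e). Likewise `n` below stands for degree `n +
  -- 1`.
  obtain ⟨hC, hτ⟩ := (Extri.ExactStructure.tfae_aet4.out 0 4).1 h
  exact ⟨hC, fun n I _ => Extri.ExactStructure.isIso_tau_extSucc (hτ I) n⟩
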